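/- **The setting.** $\mathsf{GRIP}$ is a gradual dependent type theory with an impure hierarchy $\square_0:\square_1:\cdots$ of gradual types (dependent products $\Pi x{:}A.\,B$, lists $\mathbb L A$, lifts $\iota A:\square_{i+1}$ of types $A:\square_i$, boxed propositions $\mathrm{Box}\,P:\square_0$, the sort $\mathbb P:\square_0$ of pure propositions), errors $\mathrm{err}_A:A$, unknown terms $?_A:A$, casts $\langle B\Leftarrow A\rangle:A\to B$ between any two types of the same level, and propositions $A\sqsubseteq_i B$ (type precision, $A,B:\square_i$) and $a\sqsubseteq_{A,B}b$ (term precision, $a:A$, $b:B$). Write $a\sqsubseteq_A a'$ for $a\sqsubseteq_{A,A}a'$; an element $a:A$ is self-precise if $a\sqsubseteq_A a$. That a property of precision holds in $\mathsf{GRIP}$ means that it is validated by the following model, so that a constant witnessing it may be added to the theory. **The model.** Fix a hierarchy of ambient universes of small types. The universe $\square_i$ is interpreted by a type of codes, each with a small type of elements: - $\mathrm{err}_{\square_i}$, with one element, and $?_{\square_i}$, described below; - $\mathbb L A$, whose elements are generated by $\mathrm{nil}$, $\mathrm{cons}\,a\,l$, $\mathrm{err}$ and $?$; - $\Pi x{:}A.\,B$,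 whose elements are all dependent functions, $\mathrm{err}$ and $?$ being pointwise; - the ground types of the level. For $i=0$ they are $\mathbb P$, whose elements are the propositions, and $\mathrm{Box}\,P$, whose elements are $\mathrm{box}\,p$ for proofs $p$ of $P$, $\mathrm{err}$ and $?$. For $i=j+1$ they are $\square_j$, whose elements are the codes of level $j$, and $\iota A$ for $A:\square_j$, whose elements are those of $A$ (the exceptional elements of $\square_j$ are $\mathrm{err}_{\square_j}$ and $?_{\square_j}$). The elements of $?_{\square_i}$ are generated by $\mathrm{err}$, $?$, $\mathrm{in}_G(x)$ for $x$ an element of a ground type $G$ of level $i$, and $\mathrm{in}_{\mathbb L}(l)$ for $l:\mathbb L\,?_{\square_i}$; dependent functions of level $i$ are not included. *Casts* are given by recursion on codes. The cast from $\Pi x{:}A_1.B_1$ to $\Pi y{:}A_2.B_2$ sends $f$ to $\lambda y.\,\langle B_2\Leftarrow B_1[\bar y/x]\rangle(f\,\bar y)$ with $\bar y=\langle A_1\Leftarrow A_2\rangle y$. Casts between list types act entrywise and fix $\mathrm{nil},\mathrm{err},?$. The cast from $\iota A$ to $\iota A'$ is the cast from $A$ to $A'$. The casts $\square_j\to\square_j$,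 $\mathbb P\to\mathbb P$ and $?_{\square_i}\to\,?_{\square_i}$ are identities. Casts between boxes are constantly $\mathrm{err}$. The cast from a ground type $G$ to $?_{\square_i}$ is $\mathrm{in}_G$; from $\mathbb LA$ it sends $l$ to $\mathrm{in}_{\mathbb L}(\langle \mathbb L\,?\Leftarrow\mathbb LA\rangle l)$; from a product or from $\mathrm{err}_{\square_i}$ it is constantly $\mathrm{err}$. The cast from $?_{\square_i}$ to $T\ne{?_{\square_i}}$ sends $\mathrm{err}$ to $\mathrm{err}_T$, $?$ to $?_T$, $\mathrm{in}_G(x)$ to $\langle T\Leftarrow G\rangle x$ if $T$ is a ground type, $\mathrm{in}_{\mathbb L}(l)$ to $\langle T\Leftarrow\mathbb L\,?\rangle l$ if $T$ is a list type, and everything else to $\mathrm{err}_T$. All remaining casts, between types with distinct heads, are constantly $\mathrm{err}$. *Heterogeneous precision* is $a\sqsubseteq_{A,B}b:\iff a\sqsubseteq_A\langle A\Leftarrow B\rangle b\ \wedge\ b\sqsubseteq_B b$. *Term precision* $\sqsubseteq_A$ is total on $\mathrm{err}_{\square_i}$, $\mathbb P$ and $\mathrm{Box}\,P$; on $\iota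 A$ it is that of $A$; on $\square_j$ it is $A\sqsubseteq_jB\wedge B\sqsubseteq_j{?_{\square_j}}$; on $\mathbb LA$ it is the least relation that relates $\mathrm{nil}$, $\mathrm{err}$ and $?$ to themselves and $\mathrm{cons}\,a\,l$ to $\mathrm{cons}\,a'\,l'$ when $a\sqsubseteq a'$ and $l\sqsubseteq l'$, and has $\mathrm{err}\sqsubseteq l\sqsubseteq{?}$ for self-precise $l$. On $\Pi x{:}A.\,B$, $f\sqsubseteq g$ means that, for all $a\sqsubseteq_Aa'$, $f\,a\sqsubseteq_{B[a],B[a']}f\,a'$, $g\,a\sqsubseteq_{B[a],B[a']}g\,a'$ and $f\,a\sqsubseteq_{B[a],B[a']}g\,a'$. On $?_{\square_i}$ it is the least relation such that $\mathrm{err}$ and $?$ are self-precise; $\mathrm{err}\sqsubseteq x\sqsubseteq{?}$ for self-precise $x$; $\mathrm{in}_G(x)\sqsubseteq\mathrm{in}_{G'}(y)$ when $G,G'$ are self-precise types and $x\sqsubseteq_{G,G'}y$; $\mathrm{in}_{\mathbb L}(l)\sqsubseteq\mathrm{in}_{\mathbb L}(l')$ when $l\sqsubseteq l'$; and an embedded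 error ($\mathrm{in}_{\mathbb L}(\mathrm{err})$, or $\mathrm{in}_G(x)$ with $G$ self-precise and $x\sqsubseteq_G\mathrm{err}_G$) is below every self-precise element. *Type precision* $\sqsubseteq_i$ is the least relation such that: $\mathrm{err}_{\square_i}$ and $?_{\square_i}$ are self-precise; $\mathrm{err}_{\square_i}\sqsubseteq_iB$ if $B\sqsubseteq_iB$; $\square_j\sqsubseteq_{j+1}\square_j$; $\mathbb P\sqsubseteq_0\mathbb P$; $\mathrm{Box}\,P\sqsubseteq_0\mathrm{Box}\,Q$; $\iota A\sqsubseteq_{j+1}\iota B$ if $A\sqsubseteq_jB$; $G\sqsubseteq_i{?_{\square_i}}$ for self-precise ground types $G$; $\mathbb LA\sqsubseteq_i\mathbb LB$ if $A\sqsubseteq_iB$; $\mathbb LA\sqsubseteq_i{?_{\square_i}}$ if $A\sqsubseteq_i{?_{\square_i}}$; and $\Pi x{:}A.B\sqsubseteq_i\Pi x{:}A'.B'$ if $A\sqsubseteq_iA'$, $a_0\sqsubseteq_Aa_1$ implies $B[a_0]\sqsubseteq_iB[a_1]$, $a_0'\sqsubseteq_{A'}a_1'$ implies $B'[a_0']\sqsubseteq_iB'[a_1']$,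 and $a\sqsubseteq_{A,A'}a'$ implies $B[a]\sqsubseteq_iB'[a']$. **Proposition.** For every level $i$ and all $A,B:\square_i$ with $A\sqsubseteq_iB$, the casts $\uparrow\,:=\langle B\Leftarrow A\rangle:A\to B$ and $\downarrow\,:=\langle A\Leftarrow B\rangle:B\to A$ form an embedding–projection pair relativized to self-precise elements: 1. (Monotonicity) $a\sqsubseteq_Aa'$ implies $\uparrow a\sqsubseteq_B\,\uparrow a'$, and $b\sqsubseteq_Bb'$ implies $\downarrow b\sqsubseteq_A\,\downarrow b'$. 2. (Adjunction) If $a\sqsubseteq_Aa$ and $b\sqsubseteq_Bb$, then $\uparrow a\sqsubseteq_Bb$ if and only if $a\sqsubseteq_A\,\downarrow b$. 3. (Retraction) If $a\sqsubseteq_Aa$, then $\downarrow\uparrow a\sqsubseteq_Aa$ and $a\sqsubseteq_A\,\downarrow\uparrow a$. That is, the model validates the closed proposition $\forall A\,B:\square_i,\ A\sqsubseteq_iB\to(\langle B\Leftarrow A\rangle\dashv\langle A\Leftarrow B\rangle)$, which justifies adding to $\mathsf{GRIP}$ a constant inhabiting it. -/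

import Mathlib

universe v

namespace Grip

/-! ## Embedding-projection pairs relativized to self-precise elements -/

/-- `(up, down)` is an embedding-projection pair between `(X, RX)` and `(Y, RY)`. An element `x` is
self-precise when `RX x x`. The relations are not assumed to be reflexive or transitive. -/
structure IsEPPair {X Y : Type v} (RX : X → X → Prop) (RY : Y → Y → Prop)
    (up : X → Y) (down : Y → X) : Prop where
  /-- the upcast is monotone -/
  up_mono : ∀ a a' : X, RX a a' → RY (up a) (up a')
  /-- the downcast is monotone -/
  down_mono : ∀ b b' : Y, RY b b' → RX (down b) (down b')
  /-- the adjunction, on self-precise elements -/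
  adjunction : ∀ (a : X) (b : Y), RX a a → RY b b → (RY (up a) b ↔ RX a (down b))
  /-- the round trip of a self-precise element is equiprecise to it -/
  retraction : ∀ a : X, RX a a → RX (down (up a)) a ∧ RX a (down (up a))

/-! ## Inductive types extended with an error and an unknown element -/

/-- The interpretation of `𝕃 A`: lists with two additional constructors. -/
inductive ExcList (α : Type v) : Type v
  | nil : ExcList α
  | cons (a : α) (l : ExcList α) : ExcList α
  | err : ExcList α
  | unk : ExcList α

/-- Mapping a function over the entries; this is how casts act between lists. -/
def ExcList.map {α β : Type v} (f : α → β) : ExcList α → ExcList β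
  | .nil => .nil
  | .cons a l => .cons (f a) (l.map f)
  | .err => .err
  | .unk => .unk

/-- Precision of lists: congruence on constructors, `err` is below and `unk` is above every
self-precise list. -/
inductive ExcList.Rel {α : Type v} (R : α → α → Prop) : ExcList α → ExcList α → Prop
  | nil : ExcList.Rel R .nil .nil
  | cons {a a' : α} {l l' : ExcList α} :
      R a a' → ExcList.Rel R l l' → ExcList.Rel R (.cons a l) (.cons a' l')
  | err_refl : ExcList.Rel R .err .err
  | unk_refl : ExcList.Rel R .unk .unk
  | err {l : ExcList α} : ExcList.Rel R l l → ExcList.Rel R .err l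
  | unk {l : ExcList α} : ExcList.Rel R l l → ExcList.Rel R l .unk

/-- The interpretation of `𝔹ox P`, for a proposition `P`. -/
inductive ExcBox (P : Prop) : Type v
  | box (p : P) : ExcBox P
  | err : ExcBox P
  | unk : ExcBox P

/-! ## The ground types of a level -/

/-- The ground types of a universe level: the type formers that do not take types of the same level
as arguments (`ℙ` and `𝔹ox P` at level `0`; `□ᵢ` and `ι A` for `A : □ᵢ` at level `i + 1`), with their
elements, exceptional elements, casts, term precision and type precision. The only ground data used
below are `Ground.zero` and `Ground.succ`. -/
structure Ground : Type (v + 1) where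
  K : Type v
  El : K → Type v
  err : ∀ k, El k
  unk : ∀ k, El k
  cast : ∀ k l, El k → El l
  prec : ∀ k, El k → El k → Prop
  tyPrec : K → K → Prop

/-- The interpretation of the unknown type `?` of a level: it is closed under all type formers except
dependent functions. `ground k x` is the element `x` of a ground type cast into `?`, and `list l` is
an element of `𝕃 ?` cast into `?`. -/
inductive Unk (G : Ground.{v}) : Type v
  | err : Unk G
  | unk : Unk G
  | ground (k : G.K) (x : G.El k) : Unk G
  | list (l : ExcList (Unk G)) : Unk G

/-- Precision on `?`. Elements of self-precise ground types are compared by heterogeneous precision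
`x ⊑ cast y ∧ y ⊑ y`. An element cast into `?` that is an error of its own type is, like `err`,
below every self-precise element. -/
inductive Unk.Rel (G : Ground.{v}) : Unk G → Unk G → Prop
  | err_refl : Unk.Rel G .err .err
  | unk_refl : Unk.Rel G .unk .unk
  | err {y : Unk G} : Unk.Rel G y y → Unk.Rel G .err y
  | unk {x : Unk G} : Unk.Rel G x x → Unk.Rel G x .unk
  | ground {k l : G.K} {x : G.El k} {y : G.El l} :
      G.tyPrec k k → G.tyPrec l l → G.prec k x (G.cast l k y) → G.prec l y y →
      Unk.Rel G (.ground k x) (.ground l y)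
  | ground_err {k : G.K} {x : G.El k} {y : Unk G} :
      G.tyPrec k k → G.prec k x (G.err k) → Unk.Rel G y y → Unk.Rel G (.ground k x) y
  | list {l l' : ExcList (Unk G)} :
      ExcList.Rel (Unk.Rel G) l l' → Unk.Rel G (.list l) (.list l')
  | list_err {y : Unk G} : Unk.Rel G y y → Unk.Rel G (.list .err) y

/-! ## Codes for the types of a level -/

/-- A universe of small types (an ambient universe of the metatheory, à la Tarski) that is closed
under the type formers of a level with ground types `G`: the singleton, the type `Unk G`, the ground
types, lists, and dependent functions. -/
structure Host (G : Ground.{v}) : Type (v + 1) where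
  T : Type v
  el : T → Type v
  err : T
  errEquiv : el err ≃ PUnit.{v + 1}
  unk : T
  unkEquiv : el unk ≃ Unk G
  ground : G.K → T
  groundEquiv : ∀ k, el (ground k) ≃ G.El k
  list : T → T
  listEquiv : ∀ a, el (list a) ≃ ExcList (el a)
  pi : (a : T) → (el a → T) → T
  piEquiv : ∀ (a : T) (b : el a → T), el (pi a b) ≃ ((x : el a) → el (b x))

section Level

variable {G : Ground.{v}} (H : Host G)

/-- Codes for the types of a level: the error type, the unknown type, the ground types, lists and
dependent functions. The index is the small type of elements. -/
inductive Code : H.T → Type v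
  | err : Code H.err
  | unk : Code H.unk
  | ground (k : G.K) : Code (H.ground k)
  | list {a : H.T} : Code a → Code (H.list a)
  | pi {a : H.T} {b : H.el a → H.T} : Code a → (∀ x, Code (b x)) → Code (H.pi a b)

variable {H}

/-- The error `err_A`. -/
def Code.errEl : {a : H.T} → Code H a → H.el a
  | _, .err => H.errEquiv.symm PUnit.unit
  | _, .unk => H.unkEquiv.symm .err
  | _, .ground k => (H.groundEquiv k).symm (G.err k)
  | _, .list _ => (H.listEquiv _).symm .err
  | _, .pi _ cb => (H.piEquiv _ _).symm fun x => (cb x).errEl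

/-- The unknown element `?_A`. -/
def Code.unkEl : {a : H.T} → Code H a → H.el a
  | _, .err => H.errEquiv.symm PUnit.unit
  | _, .unk => H.unkEquiv.symm .unk
  | _, .ground k => (H.groundEquiv k).symm (G.unk k)
  | _, .list _ => (H.listEquiv _).symm .unk
  | _, .pi _ cb => (H.piEquiv _ _).symm fun x => (cb x).unkEl

/-- The cast from `A` to the unknown type: a list is first cast to a list of unknown elements, a
function is sent to the error. -/
def Code.toUnk : {a : H.T} → Code H a → H.el a → Unk G
  | _, .err => fun _ => .err
  | _, .unk => fun x => H.unkEquiv x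
  | _, .ground k => fun x => .ground k (H.groundEquiv k x)
  | _, .list ca => fun l => .list ((H.listEquiv _ l).map ca.toUnk)
  | _, .pi _ _ => fun _ => .err

/-- The cast from the unknown type to `A`. -/
def Code.fromUnk : {a : H.T} → Code H a → Unk G → H.el a
  | _, .err => fun _ => H.errEquiv.symm PUnit.unit
  | _, .unk => fun x => H.unkEquiv.symm x
  | _, .ground k => fun
      | .ground l y => (H.groundEquiv k).symm (G.cast l k y)
      | .unk => (H.groundEquiv k).symm (G.unk k)
      | _ => (H.groundEquiv k).symm (G.err k)
  | _, .list ca => fun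
      | .list l => (H.listEquiv _).symm (l.map ca.fromUnk)
      | .unk => (H.listEquiv _).symm .unk
      | _ => (H.listEquiv _).symm .err
  | _, .pi ca cb => fun
      | .unk => (Code.pi ca cb).unkEl
      | _ => (Code.pi ca cb).errEl

/-- The casts from `A` to `B` and from `B` to `A`, defined together by recursion on `A` because the
cast between function types is contravariant in the domains. Types with distinct heads, neither of
which is `?`, are cast to each other by the error. -/
def Code.castPair : {a : H.T} → Code H a → {b : H.T} → Code H b →
    (H.el a → H.el b) × (H.el b → H.el a)
  | _, .err, _, d => (fun _ => d.errEl, fun _ => H.errEquiv.symm PUnit.unit)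
  | _, .unk, _, d => (fun x => d.fromUnk (H.unkEquiv x), fun y => H.unkEquiv.symm (d.toUnk y))
  | _, .ground k, _, d =>
      match d with
      | .unk => (fun x => H.unkEquiv.symm ((Code.ground k).toUnk x),
          fun y => (Code.ground k).fromUnk (H.unkEquiv y))
      | .ground l => (fun x => (H.groundEquiv l).symm (G.cast k l (H.groundEquiv k x)),
          fun y => (H.groundEquiv k).symm (G.cast l k (H.groundEquiv l y)))
      | d => (fun _ => d.errEl, fun _ => (Code.ground k).errEl)
  | _, .list ca, _, d =>
      match d with
      | .unk => (fun x => H.unkEquiv.symm ((Code.list ca).toUnk x),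
          fun y => (Code.list ca).fromUnk (H.unkEquiv y))
      | .list da => (fun x => (H.listEquiv _).symm ((H.listEquiv _ x).map (ca.castPair da).1),
          fun y => (H.listEquiv _).symm ((H.listEquiv _ y).map (ca.castPair da).2))
      | d => (fun _ => d.errEl, fun _ => (Code.list ca).errEl)
  | _, .pi ca cb, _, d =>
      match d with
      | .unk => (fun x => H.unkEquiv.symm ((Code.pi ca cb).toUnk x),
          fun y => (Code.pi ca cb).fromUnk (H.unkEquiv y))
      | .pi da db =>
          (fun f => (H.piEquiv _ _).symm fun y =>
            ((cb ((ca.castPair da).2 y)).castPair (db y)).1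
              (H.piEquiv _ _ f ((ca.castPair da).2 y)),
          fun g => (H.piEquiv _ _).symm fun x =>
            ((cb x).castPair (db ((ca.castPair da).1 x))).2
              (H.piEquiv _ _ g ((ca.castPair da).1 x)))
      | d => (fun _ => d.errEl, fun _ => (Code.pi ca cb).errEl)

/-- The cast from `A` to `B`. -/
def Code.cast {a b : H.T} (c : Code H a) (d : Code H b) : H.el a → H.el b := (c.castPair d).1

/-- The two components of `castPair` do not depend on the type on which the recursion is made. -/
theorem Code.castPair_swap {a : H.T} (c : Code H a) {b : H.T} (d : Code H b) :
    d.castPair c = (c.castPair d).swap := by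
  induction c generalizing b with
  | err => cases d <;> rfl
  | unk => cases d <;> rfl
  | ground k => cases d <;> rfl
  | list ca ih =>
    cases d with
    | list da => simp only [Code.castPair, ih da, Prod.swap_prod_mk, Prod.fst_swap, Prod.snd_swap]
    | _ => rfl
  | pi ca cb iha ihb =>
    cases d with
    | pi da db =>
      simp only [Code.castPair, ihb, Prod.swap_prod_mk, Prod.fst_swap, Prod.snd_swap]
      have h := iha da
      generalize da.castPair ca = p at h
      subst h
      rfl
    | _ => rfl

/-- The cast between function types, as a reduction rule. -/
theorem Code.cast_pi {a a' : H.T} {b : H.el a → H.T} {b' : H.el a' → H.T} (c : Code H a)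
    (d : ∀ x, Code H (b x)) (c' : Code H a') (d' : ∀ x, Code H (b' x)) (f : H.el (H.pi a b)) :
    (Code.pi c d).cast (Code.pi c' d') f = (H.piEquiv a' b').symm fun y =>
      (d (c'.cast c y)).cast (d' y) (H.piEquiv a b f (c'.cast c y)) := by
  have h := Code.castPair_swap c c'
  simp only [Code.cast, Code.castPair]
  generalize c'.castPair c = p at h
  subst h
  rfl

/-- Term precision `x ⊑_A y`. -/
def Code.prec : {a : H.T} → Code H a → H.el a → H.el a → Prop
  | _, .err => fun _ _ => True
  | _, .unk => fun x y => Unk.Rel G (H.unkEquiv x) (H.unkEquiv y)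
  | _, .ground k => fun x y => G.prec k (H.groundEquiv k x) (H.groundEquiv k y)
  | _, .list ca => fun x y => ExcList.Rel ca.prec (H.listEquiv _ x) (H.listEquiv _ y)
  | _, .pi ca cb => fun f g =>
      -- heterogeneous precision between the fibres of the codomain
      let hprec := fun x x' (y : H.el _) (y' : H.el _) =>
        (cb x).prec y ((cb x').cast (cb x) y') ∧ (cb x').prec y' y'
      (∀ x x', ca.prec x x' → hprec x x' (H.piEquiv _ _ f x) (H.piEquiv _ _ f x')) ∧
      (∀ x x', ca.prec x x' → hprec x x' (H.piEquiv _ _ g x) (H.piEquiv _ _ g x')) ∧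
      (∀ x x', ca.prec x x' → hprec x x' (H.piEquiv _ _ f x) (H.piEquiv _ _ g x'))

/-- Heterogeneous term precision `x ⊑_{A,B} y`. -/
def Code.hprec {a b : H.T} (c : Code H a) (d : Code H b) (x : H.el a) (y : H.el b) : Prop :=
  c.prec x (d.cast c y) ∧ d.prec y y

/-- Type precision `A ⊑ B`. Function types are not below the unknown type. -/
inductive Code.TyPrec : {a b : H.T} → Code H a → Code H b → Prop
  | err_refl : Code.TyPrec .err .err
  | err {b : H.T} {d : Code H b} : Code.TyPrec d d → Code.TyPrec .err d
  | unk_refl : Code.TyPrec .unk .unk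
  | ground {k l : G.K} : G.tyPrec k l → Code.TyPrec (.ground k) (.ground l)
  | ground_unk {k : G.K} : G.tyPrec k k → Code.TyPrec (.ground k) .unk
  | list {a b : H.T} {c : Code H a} {d : Code H b} :
      Code.TyPrec c d → Code.TyPrec (.list c) (.list d)
  | list_unk {a : H.T} {c : Code H a} : Code.TyPrec c .unk → Code.TyPrec (.list c) .unk
  | pi {a a' : H.T} {b : H.el a → H.T} {b' : H.el a' → H.T} {c : Code H a} {c' : Code H a'}
      {d : ∀ x, Code H (b x)} {d' : ∀ x, Code H (b' x)} :
      Code.TyPrec c c' →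
      (∀ x₀ x₁, c.prec x₀ x₁ → Code.TyPrec (d x₀) (d x₁)) →
      (∀ x₀ x₁, c'.prec x₀ x₁ → Code.TyPrec (d' x₀) (d' x₁)) →
      (∀ x x', c.hprec c' x x' → Code.TyPrec (d x) (d' x')) →
      Code.TyPrec (.pi c d) (.pi c' d')

end Level

/-! ## The hierarchy of universes -/

/-- The components of the interpretation of one universe `□ᵢ`: types, their elements, the exceptional
types and elements, casts, term precision and type precision. The only such data in the theorem are
those produced by `Host.univ`. -/
structure Univ : Type (v + 1) where
  Ty : Type v
  El : Ty → Type v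
  errTy : Ty
  unkTy : Ty
  err : ∀ A, El A
  unk : ∀ A, El A
  cast : ∀ A B, El A → El B
  prec : ∀ A, El A → El A → Prop
  tyPrec : Ty → Ty → Prop

/-- The universe of coded small types. -/
def Host.univ {G : Ground.{v}} (H : Host G) : Univ.{v} where
  Ty := Σ a : H.T, Code H a
  El A := H.el A.1
  errTy := ⟨_, .err⟩
  unkTy := ⟨_, .unk⟩
  err A := A.2.errEl
  unk A := A.2.unkEl
  cast A B := A.2.cast B.2
  prec A := A.2.prec
  tyPrec A B := A.2.TyPrec B.2

/-- Names of the ground types of level `0`. -/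
inductive ZeroName : Type v
  | prop : ZeroName
  | box (P : Prop) : ZeroName

/-- The ground types of level `0`: `ℙ`, and `𝔹ox P` for every proposition `P`. Precision between
propositions, between boxes and between boxed proofs is degenerate, and a cast between boxes is an
error. -/
def Ground.zero : Ground.{v} where
  K := ZeroName
  El
    | .prop => ULift Prop
    | .box P => ExcBox P
  err
    | .prop => ULift.up False
    | .box _ => .err
  unk
    | .prop => ULift.up True
    | .box _ => .unk
  cast
    | .prop, .prop => fun P => P
    | .box _, .prop => fun _ => ULift.up False
    | _, .box _ => fun _ => .err
  prec _ _ _ := True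
  tyPrec
    | .prop, .prop => True
    | .box _, .box _ => True
    | _, _ => False

/-- Names of the ground types of level `i + 1`. -/
inductive SuccName (V : Univ.{v}) : Type v
  | univ : SuccName V
  | lift (A : V.Ty) : SuccName V

/-- The ground types of level `i + 1`, where `V` interprets `□ᵢ`: the universe `□ᵢ`, and `ι A` for
every `A : □ᵢ`, whose elements are those of `A` (the coercions between `A` and `ι A` are identities).
Types are related as elements of `□ᵢ` when they are related as types and lie below `?`. -/
def Ground.succ (V : Univ.{v}) : Ground.{v} where
  K := SuccName V
  El
    | .univ => V.Ty
    | .lift A => V.El A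
  err
    | .univ => V.errTy
    | .lift A => V.err A
  unk
    | .univ => V.unkTy
    | .lift A => V.unk A
  cast
    | .univ, .univ => fun A => A
    | .lift A, .lift B => V.cast A B
    | .lift _, .univ => fun _ => V.errTy
    | .univ, .lift B => fun _ => V.err B
  prec
    | .univ => fun A B => V.tyPrec A B ∧ V.tyPrec B V.unkTy
    | .lift A => V.prec A
  tyPrec
    | .univ, .univ => True
    | .lift A, .lift B => V.tyPrec A B
    | _, _ => False

/-- `IsLevel i V`: the data `V` interpret the universe `□ᵢ`, in a hierarchy of universes
`□₀ : □₁ : ⋯ : □ᵢ` built over `i + 1` ambient universes of small types. -/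
inductive IsLevel : ℕ → Univ.{v} → Prop
  | zero (H : Host Ground.zero.{v}) : IsLevel 0 H.univ
  | succ {i : ℕ} {V : Univ.{v}} : IsLevel i V → (H : Host (Ground.succ V)) → IsLevel (i + 1) H.univ

end Grip

/-! The adjunction cannot be proved by a bare induction on `A ⊑ B`: casts between function types
involve casts between fibres over arguments that were themselves cast, and these fibres need not be
comparable. The remedy is a package of laws, `Ground.Laws`, about casts between arbitrary
self-precise types. Its core is lax composition, `cast_cast`: a detour through a third type can only
lose precision, `⟨C ⇐ B⟩⟨B ⇐ A⟩ x ⊑ ⟨C ⇐ A⟩ x`, with no relation assumed between `A`, `B` and `C`.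
With `C = A`, and since identity casts are equiprecise to the identity, this gives the counit. Only
the unit, `x ⊑ ⟨A ⇐ B⟩⟨B ⇐ A⟩ x`, uses `A ⊑ B`. Unit, counit, monotonicity and transitivity give the
embedding-projection pair (`isEPPair`).

The laws are proved together, since each one for functions may use several others in the fibres.
`Code.Hered.laws` derives the laws for types from those for their components, by cases on heads:
mismatched heads produce errors, which are least, and matching heads reduce to entries, fibres or
ground types. As a law involves up to three types, the recursion is an induction on an ordinal
bounding all their ranks (`Code.laws_of_rank_le`).

Finally, the levels are climbed one at a time: the laws of a level make its type precision
transitive, and this makes the universe itself a lawful ground type of the next level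
(`Univ.Lawful.succ`). -/

namespace Grip

/-! ## Precision of lists -/

namespace ExcList

variable {α β γ : Type v}

theorem map_map (g : β → γ) (f : α → β) (l : ExcList α) :
    (l.map f).map g = l.map fun x => g (f x) := by
  induction l with
  | cons a l ih => simp [map, ih]
  | _ => rfl

theorem map_id (l : ExcList α) : (l.map fun x => x) = l := by
  induction l with
  | cons a l ih => simp [map, ih]
  | _ => rfl

namespace Rel

/-- The three conclusions need a joint induction: for `err ⊑ l` the mixed one requires the image of
`l` under `g` to be self-precise, and for `l ⊑ ?` the image under `f`. -/
theorem map {R : α → α → Prop} {S : β → β → Prop} {f g : α → β}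
    (hf : ∀ x y, R x y → S (f x) (f y)) (hg : ∀ x y, R x y → S (g x) (g y))
    (hfg : ∀ x y, R x y → S (f x) (g y)) {l l' : ExcList α} (h : Rel R l l') :
    Rel S (l.map f) (l'.map f) ∧ Rel S (l.map g) (l'.map g) ∧ Rel S (l.map f) (l'.map g) := by
  induction h with
  | nil => exact ⟨.nil, .nil, .nil⟩
  | cons h _ ih =>
    exact ⟨.cons (hf _ _ h) ih.1, .cons (hg _ _ h) ih.2.1, .cons (hfg _ _ h) ih.2.2⟩
  | err_refl => exact ⟨.err_refl, .err_refl, .err_refl⟩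
  | unk_refl => exact ⟨.unk_refl, .unk_refl, .unk_refl⟩
  | err _ ih => exact ⟨.err ih.1, .err ih.2.1, .err ih.2.1⟩
  | unk _ ih => exact ⟨.unk ih.1, .unk ih.2.1, .unk ih.1⟩

theorem map_same {R : α → α → Prop} {S : β → β → Prop} {f : α → β}
    (hf : ∀ x y, R x y → S (f x) (f y)) {l l' : ExcList α} (h : Rel R l l') :
    Rel S (l.map f) (l'.map f) :=
  (h.map hf hf hf).1

theorem self {R S : α → α → Prop} (h : ∀ x y, R x y → S x x ∧ S y y) {l l' : ExcList α}
    (hl : Rel R l l') : Rel S l l ∧ Rel S l' l' := by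
  induction hl with
  | nil => exact ⟨.nil, .nil⟩
  | cons h' _ ih => exact ⟨.cons (h _ _ h').1 ih.1, .cons (h _ _ h').2 ih.2⟩
  | err_refl => exact ⟨.err_refl, .err_refl⟩
  | unk_refl => exact ⟨.unk_refl, .unk_refl⟩
  | err _ ih => exact ⟨.err_refl, ih.1⟩
  | unk _ ih => exact ⟨ih.1, .unk_refl⟩

/-- Two relations are allowed so that this applies inside an induction on `Unk.Rel`, where `R` also
carries the inductive hypothesis for the entries. -/
theorem trans {R S : α → α → Prop} (hR : ∀ x y, R x y → S x x ∧ S y y)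
    (hS : ∀ x y, S x y → S x x ∧ S y y)
    (h : ∀ x y z, R x y → S y z → S x z) {l l' : ExcList α}
    (hl : Rel R l l') : ∀ {l'' : ExcList α}, Rel S l' l'' → Rel S l l'' := by
  induction hl with
  | nil => exact id
  | cons h₁ hl ih =>
    intro l'' h'
    cases h' with
    | cons h₂ h' => exact .cons (h _ _ _ h₁ h₂) (ih h')
    | unk _ => exact .unk (.cons (hR _ _ h₁).1 (hl.self hR).1)
  | err_refl => exact id
  | unk_refl => exact id
  | err _ _ => exact fun h' => .err (h'.self hS).2
  | unk hl _ =>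
    intro l'' h'
    cases h' with
    | unk_refl => exact .unk (hl.self hR).1
    | unk _ => exact .unk (hl.self hR).1

/-- Comparing `f` and `g` at self-precise entries suffices: `f x ⊑ g x ⊑ g y`. -/
theorem map_le {R : α → α → Prop} {S : β → β → Prop} {f g : α → β}
    (hR : ∀ x y, R x y → R x x) (hS : ∀ x y z, S x y → S y z → S x z)
    (hf : ∀ x y, R x y → S (f x) (f y)) (hg : ∀ x y, R x y → S (g x) (g y))
    (hfg : ∀ x, R x x → S (f x) (g x)) {l l' : ExcList α} (h : Rel R l l') :
    Rel S (l.map f) (l'.map g) :=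
  (h.map hf hg fun _ _ h => hS _ _ _ (hfg _ (hR _ _ h)) (hg _ _ h)).2.2

theorem map_le_self {R : α → α → Prop} {f : α → α} (hR : ∀ x y, R x y → R x x)
    (ht : ∀ x y z, R x y → R y z → R x z) (hf : ∀ x y, R x y → R (f x) (f y))
    (h : ∀ x, R x x → R (f x) x) {l : ExcList α} (hl : Rel R l l) : Rel R (l.map f) l := by
  simpa only [map_id] using hl.map_le (g := fun x => x) hR ht hf (fun _ _ h => h) h

theorem le_map_self {R : α → α → Prop} {f : α → α} (hR : ∀ x y, R x y → R x x)
    (ht : ∀ x y z, R x y → R y z → R x z) (hf : ∀ x y, R x y → R (f x) (f y))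
    (h : ∀ x, R x x → R x (f x)) {l : ExcList α} (hl : Rel R l l) : Rel R l (l.map f) := by
  simpa only [map_id] using hl.map_le (f := fun x => x) hR ht (fun _ _ h => h) hf h

theorem eq_err {R : α → α → Prop} {l : ExcList α} (h : Rel R l .err) : l = .err := by
  cases h <;> rfl

end Rel

end ExcList

/-! ## Laws of casts and precision -/

/-- The laws of precision and casts for the types satisfying `S`. -/
structure Ground.Laws (G : Ground.{v}) (S : G.K → Prop) : Prop where
  left {k x y} : S k → G.prec k x y → G.prec k x x
  right {k x y} : S k → G.prec k x y → G.prec k y y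
  trans {k x y z} : S k → G.prec k x y → G.prec k y z → G.prec k x z
  err_self {k} : S k → G.prec k (G.err k) (G.err k)
  unk_self {k} : S k → G.prec k (G.unk k) (G.unk k)
  err_le {k x} : S k → G.prec k x x → G.prec k (G.err k) x
  le_unk {k x} : S k → G.prec k x x → G.prec k x (G.unk k)
  cast_err {k l} : S k → S l → G.prec l (G.cast k l (G.err k)) (G.err l)
  cast_mono {k l x y} : S k → S l → G.prec k x y → G.prec l (G.cast k l x) (G.cast k l y)
  cast_cast {k l m x} : S k → S l → S m → G.prec k x x →
    G.prec m (G.cast l m (G.cast k l x)) (G.cast k m x)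
  cast_self_le {k x} : S k → G.prec k x x → G.prec k (G.cast k k x) x
  le_cast_self {k x} : S k → G.prec k x x → G.prec k x (G.cast k k x)
  unit {k l x} : S k → S l → G.tyPrec k l → G.prec k x x →
    G.prec k x (G.cast l k (G.cast k l x))

namespace Ground.Laws

variable {G : Ground.{v}} {S : G.K → Prop} (L : G.Laws S) {k l m : G.K}

/-- The counit is lax composition back to `k` followed by removal of an identity cast; it does not
need `k ⊑ l`. -/
theorem roundtrip_le (L : G.Laws S) {x : G.El k} (hk : S k) (hl : S l) (hx : G.prec k x x) :
    G.prec k (G.cast l k (G.cast k l x)) x :=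
  L.trans hk (L.cast_cast hk hl hk hx) (L.cast_self_le hk hx)

theorem cast_le_iff (L : G.Laws S) {x : G.El k} {y : G.El l} (hk : S k) (hl : S l)
    (h : G.tyPrec k l) (hx : G.prec k x x) (hy : G.prec l y y) :
    G.prec l (G.cast k l x) y ↔ G.prec k x (G.cast l k y) :=
  ⟨fun h' => L.trans hk (L.unit hk hl h hx) (L.cast_mono hl hk h'),
    fun h' => L.trans hl (L.cast_mono hk hl h') (L.roundtrip_le hl hk hy)⟩

/-- A cast can be factored through a less precise target. -/
theorem le_cast_cast (L : G.Laws S) {x : G.El m} (hk : S k) (hl : S l) (hm : S m)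
    (h : G.tyPrec k l) (hx : G.prec m x x) :
    G.prec k (G.cast m k x) (G.cast l k (G.cast m l x)) :=
  -- Transposes lax composition along `m`, `k`, `l`.
  (L.cast_le_iff hk hl h (L.cast_mono hm hk hx) (L.cast_mono hm hl hx)).1
    (L.cast_cast hm hk hl hx)

theorem isEPPair (L : G.Laws S) (hk : S k) (hl : S l) (h : G.tyPrec k l) :
    IsEPPair (G.prec k) (G.prec l) (G.cast k l) (G.cast l k) where
  up_mono _ _ := L.cast_mono hk hl
  down_mono _ _ := L.cast_mono hl hk
  adjunction _ _ := L.cast_le_iff hk hl h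
  retraction _ hx := ⟨L.roundtrip_le hk hl hx, L.unit hk hl h hx⟩

/-- Laws may be checked on triples of types. -/
theorem of_triples (h : ∀ k l m, S k → S l → S m → ∃ S', G.Laws S' ∧ S' k ∧ S' l ∧ S' m) :
    G.Laws S where
  left {k _ _} hk := by
    obtain ⟨S', L, hk, -, -⟩ := h k k k hk hk hk; exact L.left hk
  right {k _ _} hk := by
    obtain ⟨S', L, hk, -, -⟩ := h k k k hk hk hk; exact L.right hk
  trans {k _ _ _} hk := by
    obtain ⟨S', L, hk, -, -⟩ := h k k k hk hk hk; exact L.trans hk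
  err_self {k} hk := by
    obtain ⟨S', L, hk, -, -⟩ := h k k k hk hk hk; exact L.err_self hk
  unk_self {k} hk := by
    obtain ⟨S', L, hk, -, -⟩ := h k k k hk hk hk; exact L.unk_self hk
  err_le {k _} hk := by
    obtain ⟨S', L, hk, -, -⟩ := h k k k hk hk hk; exact L.err_le hk
  le_unk {k _} hk := by
    obtain ⟨S', L, hk, -, -⟩ := h k k k hk hk hk; exact L.le_unk hk
  cast_err {k l} hk hl := by
    obtain ⟨S', L, hk, hl, -⟩ := h k l l hk hl hl; exact L.cast_err hk hl
  cast_mono {k l _ _} hk hl := by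
    obtain ⟨S', L, hk, hl, -⟩ := h k l l hk hl hl; exact L.cast_mono hk hl
  cast_cast {k l m _} hk hl hm := by
    obtain ⟨S', L, hk, hl, hm⟩ := h k l m hk hl hm; exact L.cast_cast hk hl hm
  cast_self_le {k _} hk := by
    obtain ⟨S', L, hk, -, -⟩ := h k k k hk hk hk; exact L.cast_self_le hk
  le_cast_self {k _} hk := by
    obtain ⟨S', L, hk, -, -⟩ := h k k k hk hk hk; exact L.le_cast_self hk
  unit {k l _} hk hl := by
    obtain ⟨S', L, hk, hl, -⟩ := h k l l hk hl hl; exact L.unit hk hl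

end Ground.Laws

/-- The laws hold for self-precise types, and type precision is transitive and reflexive on the
types it relates. -/
structure Ground.Lawful (G : Ground.{v}) : Prop where
  laws : G.Laws fun k => G.tyPrec k k
  tyPrec_self {k l} : G.tyPrec k l → G.tyPrec k k ∧ G.tyPrec l l
  tyPrec_trans {k l m} : G.tyPrec k l → G.tyPrec l m → G.tyPrec k m

/-! ## Precision on the unknown type -/

namespace Unk.Rel

variable {G : Ground.{v}}

/-- Induction on precision of the unknown type, with an inductive hypothesis on list entries. -/
theorem induct {motive : ∀ x y : Unk G, Unk.Rel G x y → Prop}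
    (err_refl : motive .err .err .err_refl) (unk_refl : motive .unk .unk .unk_refl)
    (err : ∀ {y} (h : Unk.Rel G y y), motive y y h → motive .err y (.err h))
    (unk : ∀ {x} (h : Unk.Rel G x x), motive x x h → motive x .unk (.unk h))
    (ground : ∀ {k l x y} (hk : G.tyPrec k k) (hl : G.tyPrec l l)
      (hx : G.prec k x (G.cast l k y)) (hy : G.prec l y y),
      motive (.ground k x) (.ground l y) (.ground hk hl hx hy))
    (ground_err : ∀ {k x y} (hk : G.tyPrec k k) (hx : G.prec k x (G.err k))
      (hy : Unk.Rel G y y), motive y y hy → motive (.ground k x) y (.ground_err hk hx hy))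
    (list : ∀ {l l'} (h : ExcList.Rel (Unk.Rel G) l l'),
      ExcList.Rel (fun x y => ∃ h, motive x y h) l l' → motive (.list l) (.list l') (.list h))
    (list_err : ∀ {y} (h : Unk.Rel G y y), motive y y h → motive (.list .err) y (.list_err h))
    {x y : Unk G} (h : Unk.Rel G x y) : motive x y h :=
  -- The second motive, for the nested list relation, stores each related pair of entries together
  -- with its inductive hypothesis.
  Unk.Rel.rec (motive_1 := motive)
    (motive_2 := fun l l' _ => ExcList.Rel (fun x y => ∃ h, motive x y h) l l')
    err_refl unk_refl err unk ground ground_err list list_err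
    .nil (fun h _ ih ih' => .cons ⟨h, ih⟩ ih') .err_refl .unk_refl
    (fun _ ih => .err ih) (fun _ ih => .unk ih) h

variable (L : G.Laws fun k => G.tyPrec k k)
include L

/-- The constructor `ground` inserts the cast from `k` to itself, which need not be the identity
(between boxes it is an error), hence the use of `le_cast_self`. -/
theorem ground_mono {k : G.K} {x y : G.El k} (hk : G.tyPrec k k) (h : G.prec k x y) :
    Unk.Rel G (.ground k x) (.ground k y) :=
  .ground hk hk (L.trans hk h (L.le_cast_self hk (L.right hk h))) (L.right hk h)

theorem self {x y : Unk G} (h : Unk.Rel G x y) : Unk.Rel G x x ∧ Unk.Rel G y y := by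
  induction h using Unk.Rel.induct with
  | err_refl => exact ⟨.err_refl, .err_refl⟩
  | unk_refl => exact ⟨.unk_refl, .unk_refl⟩
  | err h _ => exact ⟨.err_refl, h⟩
  | unk h _ => exact ⟨h, .unk_refl⟩
  | ground hk hl hx hy => exact ⟨ground_mono L hk (L.left hk hx), ground_mono L hl hy⟩
  | ground_err hk hx hy _ => exact ⟨ground_mono L hk (L.left hk hx), hy⟩
  | list h₀ h =>
    have := h.self (S := Unk.Rel G) fun _ _ ⟨_, h⟩ => h
    exact ⟨.list this.1, .list this.2⟩
  | list_err h _ => exact ⟨.list .err_refl, h⟩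

theorem trans {x y z : Unk G} (h : Unk.Rel G x y) (h' : Unk.Rel G y z) : Unk.Rel G x z := by
  induction h using Unk.Rel.induct generalizing z with
  | err_refl => exact h'
  | unk_refl => exact h'
  | err _ _ => exact .err (self L h').2
  | unk h _ =>
    cases h' with
    | unk_refl => exact .unk h
    | unk _ => exact .unk h
  | ground hk hl hx hy =>
    cases h' with
    | unk _ => exact .unk (ground_mono L hk (L.left hk hx))
    | ground _ hm hy' hz =>
      -- `x ⊑ cast y ⊑ cast (cast z) ⊑ cast z`, the last step by lax composition.
      exact .ground hk hm (L.trans hk hx (L.trans hk (L.cast_mono hl hk hy')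
        (L.cast_cast hm hl hk hz))) hz
    | ground_err _ hy' hz =>
      exact .ground_err hk (L.trans hk hx (L.trans hk (L.cast_mono hl hk hy')
        (L.cast_err hl hk))) hz
  | ground_err hk hx _ _ => exact .ground_err hk hx (self L h').2
  | list h₀ h =>
    cases h' with
    | unk _ => exact .unk (.list (h₀.self fun _ _ => self L).1)
    | list h' =>
      refine .list (ExcList.Rel.trans (S := Unk.Rel G) ?_ (fun _ _ => self L) ?_ h h')
      · exact fun _ _ ⟨h, _⟩ => self L h
      · exact fun _ _ _ ⟨_, h⟩ h' => h h'
    | list_err hz => cases h.eq_err; exact .list_err hz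
  | list_err _ _ => exact .list_err (self L h').2

/-- If the relation comes from `ground_err`, then `x ⊑ err ⊑ y` in `k`. -/
theorem of_ground {k : G.K} {x y : G.El k} (h : Unk.Rel G (.ground k x) (.ground k y)) :
    G.tyPrec k k ∧ G.prec k x y := by
  cases h with
  | ground hk _ hx hy => exact ⟨hk, L.trans hk hx (L.cast_self_le hk hy)⟩
  | ground_err hk hx hy =>
    cases hy with
    | ground _ _ _ hy => exact ⟨hk, L.trans hk hx (L.err_le hk hy)⟩
    | ground_err _ hy _ => exact ⟨hk, L.trans hk hx (L.err_le hk (L.left hk hy))⟩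

omit L in
theorem of_list {l : ExcList (Unk G)} (h : Unk.Rel G (.list l) (.list l)) :
    ExcList.Rel (Unk.Rel G) l l := by
  cases h with
  | list h => exact h
  | list_err _ => exact .err_refl

end Unk.Rel

end Grip

namespace Grip

/-- The types of a universe, viewed as ground types. -/
def Univ.types (V : Univ.{v}) : Ground.{v} where
  K := V.Ty
  El := V.El
  err := V.err
  unk := V.unk
  cast := V.cast
  prec := V.prec
  tyPrec := V.tyPrec

namespace Code

variable {G : Ground.{v}} {H : Host G}

/-! ## Casts between codes -/

/-- With `fromUnk_eq`, turns the laws for casts to and from the code `unk` into statements about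
`toUnk` and `fromUnk`, the form in which they act on list entries. -/
theorem toUnk_eq {a : H.T} (c : Code H a) (x : H.el a) :
    c.toUnk x = H.unkEquiv (c.cast .unk x) := by
  cases c <;> simp [toUnk, cast, castPair, errEl, fromUnk]

theorem fromUnk_eq {a : H.T} (c : Code H a) (u : Unk G) :
    c.fromUnk u = Code.unk.cast c (H.unkEquiv.symm u) := by
  simp [cast, castPair]

theorem unk_cast_unk (x : H.el H.unk) : (Code.unk : Code H _).cast .unk x = x := by
  simp [cast, castPair, fromUnk]

theorem fromUnk_err {a : H.T} (c : Code H a) : c.fromUnk .err = c.errEl := by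
  cases c <;> rfl

theorem fromUnk_unk {a : H.T} (c : Code H a) : c.fromUnk .unk = c.unkEl := by
  cases c <;> rfl

/-- Inversion of type precision. -/
def TyPrecInv : {a b : H.T} → Code H a → Code H b → Prop
  | _, _, .err, d => d.TyPrec d
  | _, _, .unk, .unk => True
  | _, _, .ground k, .ground l => G.tyPrec k l
  | _, _, .ground k, .unk => G.tyPrec k k
  | _, _, .list c, .list d => c.TyPrec d
  | _, _, .list c, .unk => c.TyPrec (.unk : Code H _)
  | _, _, .pi c d, .pi c' d' =>
      c.TyPrec c' ∧ (∀ x₀ x₁, c.prec x₀ x₁ → (d x₀).TyPrec (d x₁)) ∧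
      (∀ x₀ x₁, c'.prec x₀ x₁ → (d' x₀).TyPrec (d' x₁)) ∧
      ∀ x x', c.hprec c' x x' → (d x).TyPrec (d' x')
  | _, _, _, _ => False

/-- Proved for codes with variable indices: inverting at given heads would lead to equations such as
`H.list a = H.list a'`, and `H.list` need not be injective. -/
theorem TyPrec.inv {a b : H.T} {c : Code H a} {d : Code H b} (h : c.TyPrec d) :
    TyPrecInv c d := by
  cases h with
  | err_refl => exact .err_refl
  | err h => exact h
  | unk_refl => trivial
  | ground h => exact h
  | ground_unk h => exact h
  | list h => exact h
  | list_unk h => exact h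
  | pi h₁ h₂ h₃ h₄ => exact ⟨h₁, h₂, h₃, h₄⟩

/-! ## The laws for a type, from the laws for its components -/

/-- `Family S c d`: the type `c` and the fibres of the monotone family `d` over self-precise
elements satisfy `S`. -/
def Family (S : H.univ.types.K → Prop) {a : H.T} {b : H.el a → H.T} (c : Code H a)
    (d : ∀ x, Code H (b x)) : Prop :=
  S ⟨_, c⟩ ∧ ∀ x x', c.prec x x' → S ⟨_, d x⟩ ∧ S ⟨_, d x'⟩ ∧ (d x).TyPrec (d x')

/-- The components of a self-precise type satisfy `S`. -/
def Hered (S : H.univ.types.K → Prop) : {a : H.T} → Code H a → Prop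
  | _, .err => True
  | _, .unk => True
  | _, .ground k => G.tyPrec k k
  -- Casting lists to and from `?` casts the entries to and from `?`, so the laws for entries must
  -- cover this type too.
  | _, .list c => S ⟨_, c⟩ ∧ S ⟨_, .unk⟩
  | _, .pi c d => Family S c d

/-- The action of a cast on dependent functions. -/
def castFun {a a' : H.T} {b : H.el a → H.T} {b' : H.el a' → H.T} (c : Code H a)
    (d : ∀ x, Code H (b x)) (c' : Code H a') (d' : ∀ x, Code H (b' x)) (f : ∀ x, H.el (b x)) :
    ∀ y, H.el (b' y) :=
  fun y => (d (c'.cast c y)).cast (d' y) (f (c'.cast c y))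

theorem cast_pi_eq {a a' : H.T} {b : H.el a → H.T} {b' : H.el a' → H.T} (c : Code H a)
    (d : ∀ x, Code H (b x)) (c' : Code H a') (d' : ∀ x, Code H (b' x)) (f : H.el (H.pi a b)) :
    H.piEquiv _ _ ((Code.pi c d).cast (Code.pi c' d') f) =
      castFun c d c' d' (H.piEquiv _ _ f) := by
  rw [cast_pi, Equiv.apply_symm_apply]; rfl

/-- Precision between dependent functions that need not be monotone. -/
def FunPrec {a : H.T} {b : H.el a → H.T} (c : Code H a) (d : ∀ x, Code H (b x))
    (f g : ∀ x, H.el (b x)) : Prop :=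
  ∀ x x', c.prec x x' → (d x).hprec (d x') (f x) (g x')

theorem prec_pi {a : H.T} {b : H.el a → H.T} {c : Code H a} {d : ∀ x, Code H (b x)}
    {f g : H.el (H.pi a b)} : (Code.pi c d).prec f g ↔
      FunPrec c d (H.piEquiv _ _ f) (H.piEquiv _ _ f) ∧
      FunPrec c d (H.piEquiv _ _ g) (H.piEquiv _ _ g) ∧
      FunPrec c d (H.piEquiv _ _ f) (H.piEquiv _ _ g) :=
  Iff.rfl

/-! ### The laws for dependent functions -/

section Functions

variable {S : H.univ.types.K → Prop} (L : H.univ.types.Laws S)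
  {a₁ a₂ a₃ : H.T} {b₁ : H.el a₁ → H.T} {b₂ : H.el a₂ → H.T} {b₃ : H.el a₃ → H.T}
  {c₁ : Code H a₁} {d₁ : ∀ x, Code H (b₁ x)} {c₂ : Code H a₂} {d₂ : ∀ x, Code H (b₂ x)}
  {c₃ : Code H a₃} {d₃ : ∀ x, Code H (b₃ x)}
include L

theorem FunPrec.apply (h₁ : Family S c₁ d₁) {f g : ∀ x, H.el (b₁ x)} (h : FunPrec c₁ d₁ f g)
    {x : H.el a₁} (hx : c₁.prec x x) : (d₁ x).prec (f x) (g x) :=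
  have hd := (h₁.2 x x hx).1
  L.trans hd (h x x hx).1 (L.cast_self_le hd (h x x hx).2)

theorem FunPrec.self_apply (h₁ : Family S c₁ d₁) {f g : ∀ x, H.el (b₁ x)}
    (h : FunPrec c₁ d₁ f g) {x : H.el a₁} (hx : c₁.prec x x) : (d₁ x).prec (f x) (f x) :=
  L.left (h₁.2 x x hx).1 (h x x hx).1

/-- Monotonicity of `g` carries the comparison from `x` to `x'`, so most of the laws below reduce to
a single self-precise argument. -/
theorem FunPrec.of_apply (h₁ : Family S c₁ d₁) {f g : ∀ x, H.el (b₁ x)}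
    (hg : FunPrec c₁ d₁ g g) (h : ∀ x, c₁.prec x x → (d₁ x).prec (f x) (g x)) :
    FunPrec c₁ d₁ f g := fun x x' hx =>
  ⟨L.trans (h₁.2 x x' hx).1 (h x (L.left h₁.1 hx)) (hg x x' hx).1, (hg x x' hx).2⟩

theorem FunPrec.trans (h₁ : Family S c₁ d₁) {f g h : ∀ x, H.el (b₁ x)}
    (hfg : FunPrec c₁ d₁ f g) (hgh : FunPrec c₁ d₁ g h) (hh : FunPrec c₁ d₁ h h) :
    FunPrec c₁ d₁ f h :=
  .of_apply L h₁ hh fun x hx => L.trans (h₁.2 x x hx).1 (hfg.apply L h₁ hx) (hgh.apply L h₁ hx)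

/-- Let `x`, `x'` be the casts of `y`, `y'`. Casting `f x ⊑ cast (g x')` to `d₂ y` and composing
laxly bounds the left side by the cast of `g x'` from `d₁ x'` to `d₂ y`; this factors through `d₂
y'` because `d₂ y ⊑ d₂ y'`. No relation between the two function types is needed. -/
theorem FunPrec.cast (h₁ : Family S c₁ d₁) (h₂ : Family S c₂ d₂) {f g : ∀ x, H.el (b₁ x)}
    (h : FunPrec c₁ d₁ f g) :
    FunPrec c₂ d₂ (castFun c₁ d₁ c₂ d₂ f) (castFun c₁ d₁ c₂ d₂ g) := by
  intro y y' hy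
  have hx : c₁.prec (c₂.cast c₁ y) (c₂.cast c₁ y') := L.cast_mono h₂.1 h₁.1 hy
  obtain ⟨hd, hd', -⟩ := h₁.2 _ _ hx
  obtain ⟨he, he', hee'⟩ := h₂.2 _ _ hy
  obtain ⟨hf, hg⟩ := h _ _ hx
  exact ⟨L.trans he (L.cast_mono hd he hf) (L.trans he (L.cast_cast hd' hd he hg)
    (L.le_cast_cast he he' hd' hee' hg)), L.cast_mono hd' he' hg⟩

/-- The domain casts run backwards, but lax composition keeps its direction there: the argument
obtained through `c₂` is below the direct one, and `f` is monotone. Lax composition in the fibres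
does the rest. -/
theorem FunPrec.cast_cast (h₁ : Family S c₁ d₁) (h₂ : Family S c₂ d₂) (h₃ : Family S c₃ d₃)
    {f : ∀ x, H.el (b₁ x)} (h : FunPrec c₁ d₁ f f) :
    FunPrec c₃ d₃ (castFun c₂ d₂ c₃ d₃ (castFun c₁ d₁ c₂ d₂ f)) (castFun c₁ d₁ c₃ d₃ f) := by
  refine .of_apply L h₃ (h.cast L h₁ h₃) fun z hz => ?_
  have hy : c₂.prec (c₃.cast c₂ z) (c₃.cast c₂ z) := L.cast_mono h₃.1 h₂.1 hz
  have hx : c₁.prec (c₂.cast c₁ (c₃.cast c₂ z)) (c₃.cast c₁ z) :=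
    L.cast_cast h₃.1 h₂.1 h₁.1 hz
  obtain ⟨hd, hd', -⟩ := h₁.2 _ _ hx
  have he := (h₂.2 _ _ hy).1
  have hk := (h₃.2 _ _ hz).1
  obtain ⟨hf, hf'⟩ := h _ _ hx
  exact L.trans hk (L.cast_cast hd he hk (L.left hd hf))
    (L.trans hk (L.cast_mono hd hk hf) (L.cast_cast hd' hd hk hf'))

theorem FunPrec.cast_self_le (h₁ : Family S c₁ d₁) {f : ∀ x, H.el (b₁ x)}
    (h : FunPrec c₁ d₁ f f) : FunPrec c₁ d₁ (castFun c₁ d₁ c₁ d₁ f) f := by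
  refine .of_apply L h₁ h fun x hx => ?_
  have hx' : c₁.prec (c₁.cast c₁ x) x := L.cast_self_le h₁.1 hx
  obtain ⟨hd, hd', hdd'⟩ := h₁.2 _ _ hx'
  obtain ⟨hf, hf'⟩ := h _ _ hx'
  -- Monotonicity of `f` at `cast x ⊑ x`, transposed along the precision of the fibres.
  exact (L.cast_le_iff hd hd' hdd' (L.left hd hf) hf').2 hf

theorem FunPrec.le_cast_self (h₁ : Family S c₁ d₁) {f : ∀ x, H.el (b₁ x)}
    (h : FunPrec c₁ d₁ f f) : FunPrec c₁ d₁ f (castFun c₁ d₁ c₁ d₁ f) :=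
  .of_apply L h₁ (h.cast L h₁ h₁) fun x hx => (h x _ (L.le_cast_self h₁.1 hx)).1

theorem FunPrec.unit (h₁ : Family S c₁ d₁) (h₂ : Family S c₂ d₂)
    (hc : c₁.TyPrec c₂) (hd : ∀ x x', c₁.hprec c₂ x x' → (d₁ x).TyPrec (d₂ x'))
    {f : ∀ x, H.el (b₁ x)} (h : FunPrec c₁ d₁ f f) :
    FunPrec c₁ d₁ f (castFun c₂ d₂ c₁ d₁ (castFun c₁ d₁ c₂ d₂ f)) := by
  refine .of_apply L h₁ ((h.cast L h₁ h₂).cast L h₂ h₁) fun x hx => ?_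
  have hy : c₂.prec (c₁.cast c₂ x) (c₁.cast c₂ x) := L.cast_mono h₁.1 h₂.1 hx
  have hx' : c₁.prec x (c₂.cast c₁ (c₁.cast c₂ x)) := L.unit h₁.1 h₂.1 hc hx
  obtain ⟨hk, hk', -⟩ := h₁.2 _ _ hx'
  obtain ⟨hf, hf'⟩ := h _ _ hx'
  -- `x` is heterogeneously below its upcast, so `d₁ x` is below the fibre of `d₂` there, and the
  -- cast from `d₁ x'` to `d₁ x` factors through that fibre.
  exact L.trans hk hf (L.le_cast_cast hk (h₂.2 _ _ hy).1 hk' (hd _ _ ⟨hx', hy⟩) hf')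

end Functions

end Code

end Grip

namespace Grip

/-! ### Casts through the unknown type -/

namespace Code

variable {G : Ground.{v}} {H : Host G} {S : H.univ.types.K → Prop}
  (L : H.univ.types.Laws S) (hu : S ⟨_, .unk⟩) {a b : H.T} {c : Code H a} {d : Code H b}
include L hu

theorem toUnk_mono (hc : S ⟨_, c⟩) {x y : H.el a} (h : c.prec x y) :
    Unk.Rel G (c.toUnk x) (c.toUnk y) := by
  rw [toUnk_eq, toUnk_eq]
  exact L.cast_mono hc hu h

theorem fromUnk_mono (hc : S ⟨_, c⟩) {u v : Unk G} (h : Unk.Rel G u v) :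
    c.prec (c.fromUnk u) (c.fromUnk v) := by
  rw [fromUnk_eq, fromUnk_eq]
  exact L.cast_mono hu hc (show Unk.Rel G _ _ by simpa using h)

theorem toUnk_fromUnk_le (hc : S ⟨_, c⟩) {u : Unk G} (h : Unk.Rel G u u) :
    Unk.Rel G (c.toUnk (c.fromUnk u)) u := by
  rw [fromUnk_eq, toUnk_eq]
  have : Unk.Rel G (H.unkEquiv (c.cast .unk (Code.unk.cast c (H.unkEquiv.symm u))))
      (H.unkEquiv (H.unkEquiv.symm u)) :=
    L.roundtrip_le hu hc (show Unk.Rel G _ _ by simpa using h)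
  simpa using this

theorem fromUnk_toUnk_le (hc : S ⟨_, c⟩) (hd : S ⟨_, d⟩) {x : H.el a} (h : c.prec x x) :
    d.prec (d.fromUnk (c.toUnk x)) (c.cast d x) := by
  rw [fromUnk_eq, toUnk_eq, Equiv.symm_apply_apply]
  exact L.cast_cast hc hu hd h

theorem le_fromUnk_toUnk (hc : S ⟨_, c⟩) (h : c.TyPrec (.unk : Code H _)) {x : H.el a}
    (hx : c.prec x x) : c.prec x (c.fromUnk (c.toUnk x)) := by
  rw [fromUnk_eq, toUnk_eq, Equiv.symm_apply_apply]
  exact L.unit hc hu h hx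

theorem cast_fromUnk_le (hc : S ⟨_, c⟩) (hd : S ⟨_, d⟩) {u : Unk G} (h : Unk.Rel G u u) :
    d.prec (c.cast d (c.fromUnk u)) (d.fromUnk u) := by
  rw [fromUnk_eq, fromUnk_eq]
  exact L.cast_cast hu hc hd (show Unk.Rel G _ _ by simpa using h)

theorem toUnk_cast_le (hc : S ⟨_, c⟩) (hd : S ⟨_, d⟩) {x : H.el a} (h : c.prec x x) :
    Unk.Rel G (d.toUnk (c.cast d x)) (c.toUnk x) := by
  rw [toUnk_eq, toUnk_eq]
  exact L.cast_cast hc hd hu h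

end Code

/-! ### The laws -/

namespace Code.Hered

variable {G : Ground.{v}} {H : Host G} {S : H.univ.types.K → Prop}
  (LG : G.Laws fun k => G.tyPrec k k) (L : H.univ.types.Laws S)
  {a b e : H.T} {c : Code H a} {d : Code H b} {k : Code H e}
include LG L

theorem self (hc : Hered S c) {x y : H.el a} (h : c.prec x y) : c.prec x x ∧ c.prec y y := by
  cases c with
  | err => exact ⟨trivial, trivial⟩
  | unk => exact Unk.Rel.self LG h
  | ground k => exact ⟨LG.left hc h, LG.right hc h⟩
  | list c => exact ExcList.Rel.self (fun _ _ h => ⟨L.left hc.1 h, L.right hc.1 h⟩) h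
  | pi c d => exact ⟨⟨h.1, h.1, h.1⟩, ⟨h.2.1, h.2.1, h.2.1⟩⟩

theorem trans (hc : Hered S c) {x y z : H.el a} (h : c.prec x y) (h' : c.prec y z) :
    c.prec x z := by
  cases c with
  | err => trivial
  | unk => exact Unk.Rel.trans LG h h'
  | ground k => exact LG.trans hc h h'
  | list c =>
    have hs : ∀ x y, c.prec x y → c.prec x x ∧ c.prec y y :=
      fun _ _ h => ⟨L.left hc.1 h, L.right hc.1 h⟩
    exact ExcList.Rel.trans hs hs (fun _ _ _ h h' => L.trans hc.1 h h') h h'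
  | pi c d => exact ⟨h.1, h'.2.1, FunPrec.trans L hc h.2.2 h'.2.2 h'.2.1⟩

theorem err_self (hc : Hered S c) : c.prec c.errEl c.errEl := by
  cases c with
  | err => trivial
  | unk => simpa [prec, errEl] using Unk.Rel.err_refl
  | ground k => simpa [prec, errEl] using LG.err_self hc
  | list c => simpa [prec, errEl] using ExcList.Rel.err_refl
  | pi c d =>
    have : FunPrec c d (fun x => (d x).errEl) (fun x => (d x).errEl) := fun x x' hx =>
      have ⟨hd, hd', _⟩ := hc.2 x x' hx
      ⟨L.err_le hd (L.cast_mono hd' hd (L.err_self hd')), L.err_self hd'⟩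
    simpa [prec_pi, errEl] using this

theorem unk_self (hc : Hered S c) : c.prec c.unkEl c.unkEl := by
  cases c with
  | err => trivial
  | unk => simpa [prec, unkEl] using Unk.Rel.unk_refl
  | ground k => simpa [prec, unkEl] using LG.unk_self hc
  | list c => simpa [prec, unkEl] using ExcList.Rel.unk_refl
  | pi c d =>
    have : FunPrec c d (fun x => (d x).unkEl) (fun x => (d x).unkEl) := fun x x' hx =>
      have ⟨hd, hd', h⟩ := hc.2 x x' hx
      have hu := L.unk_self hd'
      -- Transposing along `d x ⊑ d x'` leaves `cast ? ⊑ ?` in `d x'`.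
      ⟨(L.cast_le_iff hd hd' h (L.unk_self hd) hu).1
        (L.le_unk hd' (L.cast_mono hd hd' (L.unk_self hd))), hu⟩
    simpa [prec_pi, unkEl] using this

theorem err_le (hc : Hered S c) {x : H.el a} (h : c.prec x x) : c.prec c.errEl x := by
  have he := err_self LG L hc
  cases c with
  | err => trivial
  | unk => simpa [prec, errEl] using Unk.Rel.err h
  | ground k => simpa [prec, errEl] using LG.err_le hc h
  | list c => simpa [prec, errEl] using ExcList.Rel.err h
  | pi c d =>
    refine ⟨he.1, h.1, FunPrec.of_apply L hc h.1 fun x hx => ?_⟩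
    have h : (d x).prec (d x).errEl _ :=
      L.err_le (hc.2 x x hx).1 (FunPrec.self_apply L hc h.1 hx)
    simpa [errEl] using h

theorem le_unk (hc : Hered S c) {x : H.el a} (h : c.prec x x) : c.prec x c.unkEl := by
  have hu := unk_self LG L hc
  cases c with
  | err => trivial
  | unk => simpa [prec, unkEl] using Unk.Rel.unk h
  | ground k => simpa [prec, unkEl] using LG.le_unk hc h
  | list c => simpa [prec, unkEl] using ExcList.Rel.unk h
  | pi c d =>
    refine ⟨h.1, hu.1, FunPrec.of_apply L hc hu.1 fun x hx => ?_⟩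
    have h : (d x).prec _ (d x).unkEl :=
      L.le_unk (hc.2 x x hx).1 (FunPrec.self_apply L hc h.1 hx)
    simpa [unkEl] using h

theorem toUnk_mono (hc : Hered S c) {x y : H.el a} (h : c.prec x y) :
    Unk.Rel G (c.toUnk x) (c.toUnk y) := by
  cases c with
  | err => exact .err_refl
  | unk => exact h
  | ground k => exact Unk.Rel.ground_mono LG hc h
  | list c =>
    refine .list (ExcList.Rel.map_same (R := c.prec) (fun _ _ h => ?_) h)
    exact Code.toUnk_mono L hc.2 hc.1 h
  | pi c d => exact .err_refl

/-- The diagonal case comes first: when `fromUnk_mono` compares with `err`, `?` or an embedded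
error, it needs the image of the other side to be self-precise. -/
theorem fromUnk_self (hc : Hered S c) {u : Unk G} (h : Unk.Rel G u u) :
    c.prec (c.fromUnk u) (c.fromUnk u) := by
  have he := err_self LG L hc
  have hu := unk_self LG L hc
  cases c with
  | err => trivial
  | unk => simpa [prec, fromUnk] using h
  | ground k =>
    cases u with
    | ground l x =>
      have ⟨hl, hx⟩ := Unk.Rel.of_ground LG h
      simpa [prec, fromUnk] using LG.cast_mono hl hc hx
    | unk => exact hu
    | _ => exact he
  | list c =>
    cases u with
    | list l =>
      have hl : ExcList.Rel (Unk.Rel G) l l := Unk.Rel.of_list h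
      simp only [prec, fromUnk, Equiv.apply_symm_apply]
      refine hl.map_same fun _ _ h => ?_
      exact Code.fromUnk_mono L hc.2 hc.1 h
    | unk => exact hu
    | _ => exact he
  | pi c d =>
    cases u with
    | unk => exact hu
    | _ => exact he

theorem fromUnk_mono (hc : Hered S c) {u u' : Unk G} (h : Unk.Rel G u u') :
    c.prec (c.fromUnk u) (c.fromUnk u') := by
  have hu := fromUnk_self LG L hc (Unk.Rel.self LG h).1
  have hu' := fromUnk_self LG L hc (Unk.Rel.self LG h).2
  have he := err_self LG L hc
  have hle := err_le LG L hc hu'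
  cases h with
  | err_refl => exact hu
  | unk_refl => exact hu
  | err _ => rwa [fromUnk_err]
  | unk _ => rw [fromUnk_unk]; exact le_unk LG L hc hu
  | @ground k l x y hk hl hx hy =>
    cases c with
    | unk => simpa [prec, fromUnk] using Unk.Rel.ground hk hl hx hy
    | ground m =>
      simpa [prec, fromUnk] using LG.trans hc (LG.cast_mono hk hc hx) (LG.cast_cast hl hk hc hy)
    | _ => exact he
  | @ground_err k x y hk hx hy =>
    cases c with
    | unk => simpa [prec, fromUnk] using Unk.Rel.ground_err hk hx hy
    | ground m =>
      refine trans LG L hc ?_ hle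
      simpa [prec, fromUnk, errEl] using
        LG.trans hc (LG.cast_mono hk hc hx) (LG.cast_err hk hc)
    | _ => exact hle
  | @list l l' h =>
    cases c with
    | unk => simpa [prec, fromUnk] using Unk.Rel.list h
    | list c =>
      simp only [prec, fromUnk, Equiv.apply_symm_apply]
      refine h.map_same fun _ _ h => ?_
      exact Code.fromUnk_mono L hc.2 hc.1 h
    | _ => exact he
  | list_err h =>
    cases c with
    | unk => simpa [prec, fromUnk] using Unk.Rel.list_err h
    | _ => exact hle

theorem cast_mono (hc : Hered S c) (hd : Hered S d) {x y : H.el a} (h : c.prec x y) :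
    d.prec (c.cast d x) (c.cast d y) := by
  have he := err_self LG L hd
  cases c with
  | err => exact he
  | unk => exact fromUnk_mono LG L hd h
  | ground k =>
    cases d with
    | unk => simpa [prec, Code.cast, castPair] using toUnk_mono LG L hc h
    | ground l => simpa [prec, Code.cast, castPair] using LG.cast_mono hc hd h
    | _ => exact he
  | list c =>
    cases d with
    | unk => simpa [prec, Code.cast, castPair] using toUnk_mono LG L hc h
    | list d =>
      simp only [prec, Code.cast, castPair, Equiv.apply_symm_apply]
      exact ExcList.Rel.map_same (fun _ _ h => L.cast_mono hc.1 hd.1 h) h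
    | _ => exact he
  | pi c₁ d₁ =>
    cases d with
    | unk => simpa [prec, Code.cast, castPair] using toUnk_mono LG L hc h
    | pi c₂ d₂ =>
      simp only [prec_pi, cast_pi_eq]
      exact ⟨FunPrec.cast L hc hd h.1, FunPrec.cast L hc hd h.2.1, FunPrec.cast L hc hd h.2.2⟩
    | _ => exact he

/-- Errors are preserved only up to precision: in `?` the result may be an embedded error, which
`ground_err` or `list_err` places below `err`. -/
theorem cast_err (hc : Hered S c) (hd : Hered S d) : d.prec (c.cast d c.errEl) d.errEl := by
  have he := err_self LG L hd
  have hce := cast_mono LG L hc hd (err_self LG L hc)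
  cases c with
  | err => exact he
  | unk => simpa [Code.cast, castPair, errEl, fromUnk_err] using he
  | ground k =>
    cases d with
    | unk =>
      simpa [prec, Code.cast, castPair, errEl, toUnk] using
        Unk.Rel.ground_err hc (LG.err_self hc) .err_refl
    | ground l => simpa [prec, Code.cast, castPair, errEl] using LG.cast_err hc hd
    | _ => exact he
  | list c =>
    cases d with
    | unk =>
      simpa [prec, Code.cast, castPair, errEl, toUnk, ExcList.map] using
        Unk.Rel.list_err Unk.Rel.err_refl
    | list d => simpa [prec, Code.cast, castPair, errEl, ExcList.map] using ExcList.Rel.err_refl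
    | _ => exact he
  | pi c₁ d₁ =>
    cases d with
    | pi c₂ d₂ =>
      refine ⟨hce.1, he.1, FunPrec.of_apply L hd he.1 fun y hy => ?_⟩
      rw [cast_pi_eq]
      have h : (d₂ y).prec ((d₁ (c₂.cast c₁ y)).cast (d₂ y) (d₁ _).errEl) (d₂ y).errEl :=
        L.cast_err (hc.2 _ _ (L.cast_mono hd.1 hc.1 hy)).1 (hd.2 _ _ hy).1
      simpa [errEl, castFun] using h
    | _ => exact he

/-- This and `cast_cast_right` settle head mismatches: an error on either leg of the detour puts the
result below everything self-precise. -/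
theorem cast_cast_left (hc : Hered S c) (hd : Hered S d) (hk : Hered S k) {x : H.el a}
    (hx : c.prec x x) (h : c.cast d x = d.errEl) :
    k.prec (d.cast k (c.cast d x)) (c.cast k x) := by
  rw [h]
  exact trans LG L hk (cast_err LG L hd hk) (err_le LG L hk (cast_mono LG L hc hk hx))

theorem cast_cast_right (hc : Hered S c) (hk : Hered S k) {x : H.el a}
    (hx : c.prec x x) (h : d.cast k (c.cast d x) = k.errEl) :
    k.prec (d.cast k (c.cast d x)) (c.cast k x) := by
  rw [h]
  exact err_le LG L hk (cast_mono LG L hc hk hx)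

/-- An element of `?` with the wrong head is projected to an error and embedded again; the result is
below `u` exactly because embedded errors are below every self-precise element. -/
theorem roundtrip_unk (hd : Hered S d) {u : Unk G} (hu : Unk.Rel G u u) :
    Unk.Rel G (d.toUnk (d.fromUnk u)) u := by
  cases d with
  | err => exact .err hu
  | unk => simpa [toUnk, fromUnk] using hu
  | ground k =>
    cases u with
    | err => simpa [toUnk, fromUnk] using Unk.Rel.ground_err hd (LG.err_self hd) hu
    | unk => simpa [toUnk, fromUnk] using Unk.Rel.unk (Unk.Rel.ground_mono LG hd (LG.unk_self hd))
    | ground l y =>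
      obtain ⟨hl, hy⟩ := Unk.Rel.of_ground LG hu
      simpa [toUnk, fromUnk] using Unk.Rel.ground hd hl (LG.cast_mono hl hd hy) hy
    | list l => simpa [toUnk, fromUnk] using Unk.Rel.ground_err hd (LG.err_self hd) hu
  | list d =>
    cases u with
    | unk => simpa [toUnk, fromUnk, ExcList.map] using Unk.Rel.unk (.list .unk_refl)
    | list l =>
      simp only [toUnk, fromUnk, Equiv.apply_symm_apply, ExcList.map_map]
      refine .list ?_
      refine ExcList.Rel.map_le_self ?_ ?_ ?_ ?_ (Unk.Rel.of_list hu)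
      · exact fun _ _ h => (Unk.Rel.self LG h).1
      · exact fun _ _ _ => Unk.Rel.trans LG
      · exact fun _ _ h => Code.toUnk_mono L hd.2 hd.1 (Code.fromUnk_mono L hd.2 hd.1 h)
      · exact fun _ => Code.toUnk_fromUnk_le L hd.2 hd.1
    | _ => simpa [toUnk, fromUnk, ExcList.map] using Unk.Rel.list_err hu
  | pi c d => exact .err hu

/-- Unless an error arises, either all heads agree, and the claim passes to components, or `?`
occurs among the three types. A detour through `?` is exact for ground types, entrywise for lists,
and an error for functions. -/
theorem cast_cast (hc : Hered S c) (hd : Hered S d) (hk : Hered S k) {x : H.el a}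
    (hx : c.prec x x) : k.prec (d.cast k (c.cast d x)) (c.cast k x) := by
  have hm := cast_mono LG L hc hk hx
  cases c with
  | err => exact cast_cast_left LG L hc hd hk hx rfl
  | unk =>
    obtain ⟨u, rfl⟩ := H.unkEquiv.symm.surjective x
    have hu : Unk.Rel G u u := by simpa [prec] using hx
    cases d with
    | err => exact cast_cast_left LG L hc hd hk hx rfl
    | unk => simpa [unk_cast_unk] using hm
    | ground d =>
      cases k with
      | unk => simpa [prec, Code.cast, castPair, fromUnk] using roundtrip_unk LG L hd hu
      | ground k =>
        cases u with
        | err => simpa [prec, Code.cast, castPair, fromUnk] using LG.cast_err hd hk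
        | unk =>
          simpa [prec, Code.cast, castPair, fromUnk] using
            LG.le_unk hk (LG.cast_mono hd hk (LG.unk_self hd))
        | ground c x =>
          obtain ⟨hc, hx⟩ := Unk.Rel.of_ground LG hu
          simpa [prec, Code.cast, castPair, fromUnk] using LG.cast_cast hc hd hk hx
        | list l => simpa [prec, Code.cast, castPair, fromUnk] using LG.cast_err hd hk
      | _ => exact cast_cast_right LG L hc hk hx rfl
    | list d =>
      cases k with
      | unk => simpa [prec, Code.cast, castPair, fromUnk] using roundtrip_unk LG L hd hu
      | list k =>
        cases u with
        | list l =>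
          have hl := Unk.Rel.of_list hu
          simp only [prec, Code.cast, castPair, fromUnk, Equiv.apply_symm_apply,
            ExcList.map_map]
          refine ExcList.Rel.map_le ?_ ?_ ?_ ?_ ?_ hl
          · exact fun _ _ h => (Unk.Rel.self LG h).1
          · exact fun _ _ _ => L.trans hk.1
          · exact fun _ _ h => L.cast_mono hd.1 hk.1 (Code.fromUnk_mono L hd.2 hd.1 h)
          · exact fun _ _ => Code.fromUnk_mono L hk.2 hk.1
          · exact fun _ => Code.cast_fromUnk_le L hd.2 hd.1 hk.1
        | unk => simpa [prec, Code.cast, castPair, fromUnk, ExcList.map] using ExcList.Rel.unk_refl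
        | _ => simpa [prec, Code.cast, castPair, fromUnk, ExcList.map] using ExcList.Rel.err_refl
      | _ => exact cast_cast_right LG L hc hk hx rfl
    | pi c₁ d₁ =>
      cases k with
      | unk => simpa [prec, Code.cast, castPair, fromUnk] using roundtrip_unk LG L hd hu
      | pi c₂ d₂ =>
        have hce := cast_err LG L hd hk
        have hcu := le_unk LG L hk (cast_mono LG L hd hk (unk_self LG L hd))
        cases u with
        | unk => simpa [Code.cast, castPair, fromUnk] using hcu
        | _ => simpa [Code.cast, castPair, fromUnk] using hce
      | _ => exact cast_cast_right LG L hc hk hx rfl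
  | ground c =>
    cases d with
    | unk =>
      cases k with
      | unk => simpa [unk_cast_unk] using hm
      | _ => simpa [Code.cast, castPair, toUnk, fromUnk, errEl] using hm
    | ground d =>
      cases k with
      | unk =>
        simpa [prec, Code.cast, castPair, toUnk] using
          Unk.Rel.ground hd hc (LG.cast_mono hc hd hx) hx
      | ground k => simpa [prec, Code.cast, castPair] using LG.cast_cast hc hd hk hx
      | _ => exact cast_cast_right LG L hc hk hx rfl
    | _ => exact cast_cast_left LG L hc hd hk hx rfl
  | list c =>
    cases d with
    | unk =>
      cases k with
      | unk => simpa [unk_cast_unk] using hm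
      | list k =>
        simp only [prec, Code.cast, castPair, toUnk, fromUnk, Equiv.apply_symm_apply,
          ExcList.map_map]
        refine ExcList.Rel.map_le ?_ ?_ ?_ ?_ ?_ hx
        · exact fun _ _ => L.left hc.1
        · exact fun _ _ _ => L.trans hk.1
        · exact fun _ _ h => Code.fromUnk_mono L hk.2 hk.1 (Code.toUnk_mono L hc.2 hc.1 h)
        · exact fun _ _ => L.cast_mono hc.1 hk.1
        · exact fun _ => Code.fromUnk_toUnk_le L hc.2 hc.1 hk.1
      | _ => simpa [Code.cast, castPair, toUnk, fromUnk, errEl] using hm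
    | list d =>
      cases k with
      | unk =>
        simp only [prec, Code.cast, castPair, toUnk, Equiv.apply_symm_apply, ExcList.map_map]
        refine .list (ExcList.Rel.map_le ?_ ?_ ?_ ?_ ?_ hx)
        · exact fun _ _ => L.left hc.1
        · exact fun _ _ _ => Unk.Rel.trans LG
        · exact fun _ _ h => Code.toUnk_mono L hd.2 hd.1 (L.cast_mono hc.1 hd.1 h)
        · exact fun _ _ => Code.toUnk_mono L hc.2 hc.1
        · exact fun _ => Code.toUnk_cast_le L hc.2 hc.1 hd.1
      | list k =>
        simp only [prec, Code.cast, castPair, Equiv.apply_symm_apply, ExcList.map_map]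
        refine ExcList.Rel.map_le ?_ ?_ ?_ ?_ ?_ hx
        · exact fun _ _ => L.left hc.1
        · exact fun _ _ _ => L.trans hk.1
        · exact fun _ _ h => L.cast_mono hd.1 hk.1 (L.cast_mono hc.1 hd.1 h)
        · exact fun _ _ => L.cast_mono hc.1 hk.1
        · exact fun _ => L.cast_cast hc.1 hd.1 hk.1
      | _ => exact cast_cast_right LG L hc hk hx rfl
    | _ => exact cast_cast_left LG L hc hd hk hx rfl
  | pi c₁ d₁ =>
    cases d with
    | pi c₂ d₂ =>
      cases k with
      | pi c₃ d₃ =>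
        have hm' := cast_mono LG L hd hk (cast_mono LG L hc hd hx)
        refine ⟨hm'.1, hm.1, ?_⟩
        have := FunPrec.cast_cast L hc hd hk hx.1
        rwa [← cast_pi_eq, ← cast_pi_eq, ← cast_pi_eq] at this
      | _ => exact cast_cast_right LG L hc hk hx rfl
    | _ => exact cast_cast_left LG L hc hd hk hx rfl

theorem cast_self_le (hc : Hered S c) {x : H.el a} (hx : c.prec x x) :
    c.prec (c.cast c x) x := by
  have hm := cast_mono LG L hc hc hx
  cases c with
  | err => trivial
  | unk => rwa [unk_cast_unk]
  | ground k => simpa [prec, Code.cast, castPair] using LG.cast_self_le hc hx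
  | list c =>
    simp only [prec, Code.cast, castPair, Equiv.apply_symm_apply]
    refine ExcList.Rel.map_le_self ?_ ?_ ?_ ?_ hx
    · exact fun _ _ => L.left hc.1
    · exact fun _ _ _ => L.trans hc.1
    · exact fun _ _ => L.cast_mono hc.1 hc.1
    · exact fun _ => L.cast_self_le hc.1
  | pi c d =>
    refine ⟨hm.1, hx.1, ?_⟩
    have := FunPrec.cast_self_le L hc hx.1
    rwa [← cast_pi_eq] at this

theorem le_cast_self (hc : Hered S c) {x : H.el a} (hx : c.prec x x) :
    c.prec x (c.cast c x) := by
  have hm := cast_mono LG L hc hc hx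
  cases c with
  | err => trivial
  | unk => rwa [unk_cast_unk]
  | ground k => simpa [prec, Code.cast, castPair] using LG.le_cast_self hc hx
  | list c =>
    simp only [prec, Code.cast, castPair, Equiv.apply_symm_apply]
    refine ExcList.Rel.le_map_self ?_ ?_ ?_ ?_ hx
    · exact fun _ _ => L.left hc.1
    · exact fun _ _ _ => L.trans hc.1
    · exact fun _ _ => L.cast_mono hc.1 hc.1
    · exact fun _ => L.le_cast_self hc.1
  | pi c d =>
    refine ⟨hx.1, hm.1, ?_⟩
    have := FunPrec.le_cast_self L hc hx.1
    rwa [← cast_pi_eq] at this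

/-- Type precision rules out the lossy casts: distinct heads are related only below `?` or above
`err`, and functions, which `?` cannot store, are not below `?`. -/
theorem unit (hc : Hered S c) (hd : Hered S d) (h : c.TyPrec d) {x : H.el a} (hx : c.prec x x) :
    c.prec x (d.cast c (c.cast d x)) := by
  have hm := cast_mono LG L hd hc (cast_mono LG L hc hd hx)
  replace h := h.inv
  cases c with
  | err => trivial
  | unk =>
    cases d with
    | unk => rwa [unk_cast_unk, unk_cast_unk]
    | _ => exact h.elim
  | ground k =>
    cases d with
    | unk => simpa [prec, Code.cast, castPair, toUnk, fromUnk] using LG.le_cast_self hc hx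
    | ground l => simpa [prec, Code.cast, castPair] using LG.unit hc hd h hx
    | _ => exact h.elim
  | list c =>
    cases d with
    | unk =>
      simp only [prec, Code.cast, castPair, toUnk, fromUnk, Equiv.apply_symm_apply,
        ExcList.map_map]
      refine ExcList.Rel.le_map_self ?_ ?_ ?_ ?_ hx
      · exact fun _ _ => L.left hc.1
      · exact fun _ _ _ => L.trans hc.1
      · exact fun _ _ h => Code.fromUnk_mono L hc.2 hc.1 (Code.toUnk_mono L hc.2 hc.1 h)
      · exact fun _ => Code.le_fromUnk_toUnk L hc.2 hc.1 h
    | list d =>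
      simp only [prec, Code.cast, castPair, Equiv.apply_symm_apply, ExcList.map_map]
      refine ExcList.Rel.le_map_self ?_ ?_ ?_ ?_ hx
      · exact fun _ _ => L.left hc.1
      · exact fun _ _ _ => L.trans hc.1
      · exact fun _ _ h => L.cast_mono hd.1 hc.1 (L.cast_mono hc.1 hd.1 h)
      · exact fun _ => L.unit hc.1 hd.1 h
    | _ => exact h.elim
  | pi c₁ d₁ =>
    cases d with
    | pi c₂ d₂ =>
      refine ⟨hx.1, hm.1, ?_⟩
      have := FunPrec.unit L hc hd h.1 h.2.2.2 hx.1
      rwa [← cast_pi_eq, ← cast_pi_eq] at this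
    | _ => exact h.elim

/-- The laws for the components of types give the laws for the types. -/
theorem laws : H.univ.types.Laws fun A => Hered S A.2 where
  left hk h := (self LG L hk h).1
  right hk h := (self LG L hk h).2
  trans hk h h' := trans LG L hk h h'
  err_self hk := err_self LG L hk
  unk_self hk := unk_self LG L hk
  err_le hk h := err_le LG L hk h
  le_unk hk h := le_unk LG L hk h
  cast_err hk hl := cast_err LG L hk hl
  cast_mono hk hl h := cast_mono LG L hk hl h
  cast_cast hk hl hm h := cast_cast LG L hk hl hm h
  cast_self_le hk h := cast_self_le LG L hk h
  le_cast_self hk h := le_cast_self LG L hk h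
  unit hk hl h := unit LG L hk hl h

end Code.Hered

end Grip

namespace Grip

theorem Ground.Laws.mono {G : Ground.{v}} {S S' : G.K → Prop} (L : G.Laws S)
    (h : ∀ k, S' k → S k) : G.Laws S' :=
  .of_triples fun _ _ _ hk hl hm => ⟨S, L, h _ hk, h _ hl, h _ hm⟩

namespace Code

variable {G : Ground.{v}} {H : Host G}

/-! ## The laws for all self-precise types -/

/-- The height of a code. -/
noncomputable def rank : {a : H.T} → Code H a → Ordinal.{v}
  | _, .err => 0
  | _, .unk => 0
  | _, .ground _ => 0
  | _, .list c => Order.succ c.rank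
  | _, .pi c d => max (Order.succ c.rank) (⨆ x, Order.succ (d x).rank)

theorem hered_of_rank_le {α : Ordinal.{v}}
    (L : H.univ.types.Laws fun A => A.2.TyPrec A.2 ∧ A.2.rank < α) {a : H.T} {c : Code H a}
    (hc : c.TyPrec c) (hα : c.rank ≤ α) :
    Hered (fun A => A.2.TyPrec A.2 ∧ A.2.rank < α) c := by
  have h := hc.inv
  cases c with
  | err => trivial
  | unk => trivial
  | ground k => exact h
  | list c =>
    have hr : c.rank < α := Order.succ_le_iff.1 hα
    -- `?` has rank `0`, hence lies below the bound with the entry type.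
    exact ⟨⟨h, hr⟩, .unk_refl, lt_of_le_of_lt zero_le hr⟩
  | pi c d =>
    have hr : c.rank < α := Order.succ_le_iff.1 ((le_max_left _ _).trans hα)
    have hd : ∀ x, (d x).rank < α := fun x => Order.succ_le_iff.1
      ((Ordinal.le_iSup (fun x => Order.succ (d x).rank) x).trans ((le_max_right _ _).trans hα))
    exact ⟨⟨h.1, hr⟩, fun x x' hx => ⟨⟨h.2.1 x x (L.left (k := ⟨_, c⟩) ⟨h.1, hr⟩ hx), hd x⟩,
      ⟨h.2.1 x' x' (L.right (k := ⟨_, c⟩) ⟨h.1, hr⟩ hx), hd x'⟩, h.2.1 x x' hx⟩⟩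

/-- The bound is shared by all types in a law. Three types of rank below `α` have a maximal rank
below `α`, so the inductive hypothesis there yields the laws for all components. -/
theorem laws_of_rank_le (LG : G.Laws fun k => G.tyPrec k k) (α : Ordinal.{v}) :
    H.univ.types.Laws fun A => A.2.TyPrec A.2 ∧ A.2.rank ≤ α := by
  induction α using WellFoundedLT.induction with
  | ind α ih =>
    have L : H.univ.types.Laws fun A => A.2.TyPrec A.2 ∧ A.2.rank < α :=
      .of_triples fun A B C hA hB hC =>
        ⟨_, ih (max A.2.rank (max B.2.rank C.2.rank)) (max_lt hA.2 (max_lt hB.2 hC.2)),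
          ⟨hA.1, le_max_left _ _⟩, ⟨hB.1, (le_max_left _ _).trans (le_max_right _ _)⟩,
          ⟨hC.1, (le_max_right _ _).trans (le_max_right _ _)⟩⟩
    exact (Hered.laws LG L).mono fun A hA => hered_of_rank_le L hA.1 hA.2

theorem laws (LG : G.Laws fun k => G.tyPrec k k) :
    H.univ.types.Laws fun A => A.2.TyPrec A.2 :=
  .of_triples fun A B C hA hB hC =>
    ⟨_, laws_of_rank_le LG (max A.2.rank (max B.2.rank C.2.rank)),
      ⟨hA, le_max_left _ _⟩, ⟨hB, (le_max_left _ _).trans (le_max_right _ _)⟩,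
      ⟨hC, (le_max_right _ _).trans (le_max_right _ _)⟩⟩

/-! ## Type precision -/

theorem TyPrec.pi_self (L : H.univ.types.Laws fun A => A.2.TyPrec A.2) {a : H.T}
    {b : H.el a → H.T} {c : Code H a} {d : ∀ x, Code H (b x)} (hc : c.TyPrec c)
    (hd : ∀ x x', c.prec x x' → (d x).TyPrec (d x')) : (Code.pi c d).TyPrec (.pi c d) :=
  .pi hc hd hd fun x x' hx =>
    hd x x' (L.trans (k := ⟨_, c⟩) hc hx.1 (L.cast_self_le (k := ⟨_, c⟩) hc hx.2))

theorem TyPrec.self (LG : G.Lawful) {a b : H.T} {c : Code H a} {d : Code H b}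
    (h : c.TyPrec d) : c.TyPrec c ∧ d.TyPrec d := by
  have L := laws (H := H) LG.laws
  induction h with
  | err_refl => exact ⟨.err_refl, .err_refl⟩
  | err h _ => exact ⟨.err_refl, h⟩
  | unk_refl => exact ⟨.unk_refl, .unk_refl⟩
  | ground h => exact ⟨.ground (LG.tyPrec_self h).1, .ground (LG.tyPrec_self h).2⟩
  | ground_unk h => exact ⟨.ground h, .unk_refl⟩
  | list _ ih => exact ⟨.list ih.1, .list ih.2⟩
  | list_unk _ ih => exact ⟨.list ih.1, .unk_refl⟩
  | pi _ h₁ h₂ _ ih _ _ _ => exact ⟨.pi_self L ih.1 h₁, .pi_self L ih.2 h₂⟩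

theorem TyPrec.trans (LG : G.Lawful) {a b e : H.T} {c : Code H a} {d : Code H b}
    {k : Code H e} (h : c.TyPrec d) (h' : d.TyPrec k) : c.TyPrec k := by
  have L := laws (H := H) LG.laws
  induction h generalizing e with
  | err_refl => exact h'
  | err _ _ => exact .err (h'.self LG).2
  | unk_refl => exact h'
  | ground h =>
    have hi := h'.inv
    cases k with
    | unk => exact .ground_unk (LG.tyPrec_self h).1
    | ground m => exact .ground (LG.tyPrec_trans h hi)
    | _ => exact hi.elim
  | ground_unk h =>
    have hi := h'.inv
    cases k with
    | unk => exact .ground_unk h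
    | _ => exact hi.elim
  | list h ih =>
    have hi := h'.inv
    cases k with
    | unk => exact .list_unk (ih hi)
    | list k => exact .list (ih hi)
    | _ => exact hi.elim
  | list_unk h ih =>
    have hi := h'.inv
    cases k with
    | unk => exact .list_unk h
    | _ => exact hi.elim
  | @pi _ _ _ _ c c' d d' hc hd _ hdd' ih _ _ ih' =>
    have hi := h'.inv
    cases k with
    | pi c'' d'' =>
      have hc₁ := (hc.self LG).1
      have hc₂ := (hc.self LG).2
      have hc₃ := (hi.1.self LG).2
      -- The middle argument is the upcast of `x`. It is above `x` by the unit, and below `z` by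
      -- transposition, since the cast from `c''` to `c` factors through `c'`.
      refine .pi (ih hi.1) hd hi.2.2.1 fun x z hx => ?_
      have hxx : c.prec x x := L.left (k := ⟨_, c⟩) hc₁ hx.1
      have hy : c'.prec (c.cast c' x) (c.cast c' x) :=
        L.cast_mono (k := ⟨_, c⟩) (l := ⟨_, c'⟩) hc₁ hc₂ hxx
      have hz : c'.prec (c''.cast c' z) (c''.cast c' z) :=
        L.cast_mono (k := ⟨_, c''⟩) (l := ⟨_, c'⟩) hc₃ hc₂ hx.2
      have hxy : c.prec x (c'.cast c (c.cast c' x)) :=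
        L.unit (k := ⟨_, c⟩) (l := ⟨_, c'⟩) hc₁ hc₂ hc hxx
      have hyz : c'.prec (c.cast c' x) (c''.cast c' z) :=
        (L.cast_le_iff (G := H.univ.types) (k := ⟨_, c⟩) (l := ⟨_, c'⟩) hc₁ hc₂ hc hxx hz).2
          (L.trans (k := ⟨_, c⟩) hc₁ hx.1
            (L.le_cast_cast (G := H.univ.types) (k := ⟨_, c⟩) (l := ⟨_, c'⟩)
              (m := ⟨_, c''⟩) hc₁ hc₂ hc₃ hc hx.2))
      exact ih' _ _ ⟨hxy, hy⟩ (hi.2.2.2 _ _ ⟨hyz, hx.2⟩)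
    | _ => exact hi.elim

end Code

/-! ## The hierarchy -/

/-- The laws for the types of a universe, and the laws of `err` and `?` as types. -/
structure Univ.Lawful (V : Univ.{v}) : Prop where
  types : V.types.Lawful
  err_self : V.tyPrec V.errTy V.errTy
  unk_self : V.tyPrec V.unkTy V.unkTy
  err_le {A} : V.tyPrec A A → V.tyPrec V.errTy A

theorem Ground.Lawful.univ {G : Ground.{v}} (LG : G.Lawful) (H : Host G) : H.univ.Lawful where
  types :=
    { laws := Code.laws LG.laws
      tyPrec_self := fun h => Code.TyPrec.self LG h
      tyPrec_trans := fun h h' => Code.TyPrec.trans LG h h' }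
  err_self := .err_refl
  unk_self := .unk_refl
  err_le h := .err h

theorem Ground.lawful_zero : Ground.zero.{v}.Lawful where
  laws := by constructor <;> intros <;> trivial
  tyPrec_self {k l} h := by
    cases k <;> cases l <;> first | exact h.elim | exact ⟨trivial, trivial⟩
  tyPrec_trans {k l m} h h' := by
    cases k <;> cases l <;> cases m <;> first | exact h.elim | exact h'.elim | trivial

/-- On the universe, the clause `B ⊑ ?` in term precision is what makes `?` greatest: function types
are not below `?`, hence not self-precise as elements. Self-precision on the left then requires
transitivity of type precision. -/
theorem Univ.Lawful.succ {V : Univ.{v}} (LV : V.Lawful) : (Ground.succ V).Lawful where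
  laws :=
    { left := fun {k _ _} hk h => by
        cases k with
        | univ => exact ⟨(LV.types.tyPrec_self h.1).1, LV.types.tyPrec_trans h.1 h.2⟩
        | lift A => exact LV.types.laws.left hk h
      right := fun {k _ _} hk h => by
        cases k with
        | univ => exact ⟨(LV.types.tyPrec_self h.1).2, h.2⟩
        | lift A => exact LV.types.laws.right hk h
      trans := fun {k _ _ _} hk h h' => by
        cases k with
        | univ => exact ⟨LV.types.tyPrec_trans h.1 h'.1, h'.2⟩
        | lift A => exact LV.types.laws.trans hk h h'
      err_self := fun {k} hk => by
        cases k with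
        | univ => exact ⟨LV.err_self, LV.err_le LV.unk_self⟩
        | lift A => exact LV.types.laws.err_self hk
      unk_self := fun {k} hk => by
        cases k with
        | univ => exact ⟨LV.unk_self, LV.unk_self⟩
        | lift A => exact LV.types.laws.unk_self hk
      err_le := fun {k _} hk h => by
        cases k with
        | univ => exact ⟨LV.err_le h.1, h.2⟩
        | lift A => exact LV.types.laws.err_le hk h
      le_unk := fun {k _} hk h => by
        cases k with
        | univ => exact ⟨h.2, LV.unk_self⟩
        | lift A => exact LV.types.laws.le_unk hk h
      cast_err := fun {k l} hk hl => by
        have hu : V.tyPrec V.errTy V.errTy ∧ V.tyPrec V.errTy V.unkTy :=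
          ⟨LV.err_self, LV.err_le LV.unk_self⟩
        cases k <;> cases l
        · exact hu
        · exact LV.types.laws.err_self hl
        · exact hu
        · exact LV.types.laws.cast_err hk hl
      cast_mono := fun {k l _ _} hk hl h => by
        cases k <;> cases l
        · exact h
        · exact LV.types.laws.err_self hl
        · exact ⟨LV.err_self, LV.err_le LV.unk_self⟩
        · exact LV.types.laws.cast_mono hk hl h
      cast_cast := fun {k l m x} hk hl hm h => by
        have hu : V.tyPrec V.errTy V.errTy ∧ V.tyPrec V.errTy V.unkTy :=
          ⟨LV.err_self, LV.err_le LV.unk_self⟩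
        have T := LV.types.laws
        cases k <;> cases l <;> cases m
        · exact h
        · exact T.err_self hm
        · exact ⟨LV.err_le h.1, h.2⟩
        · exact T.cast_err hl hm
        · exact hu
        · exact T.err_le hm (T.cast_mono hk hm h)
        · exact hu
        · exact T.cast_cast hk hl hm h
      cast_self_le := fun {k _} hk h => by
        cases k with
        | univ => exact h
        | lift A => exact LV.types.laws.cast_self_le hk h
      le_cast_self := fun {k _} hk h => by
        cases k with
        | univ => exact h
        | lift A => exact LV.types.laws.le_cast_self hk h
      unit := fun {k l _} hk hl hkl h => by
        cases k <;> cases l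
        · exact h
        · exact hkl.elim
        · exact hkl.elim
        · exact LV.types.laws.unit hk hl hkl h }
  tyPrec_self {k l} h := by
    cases k <;> cases l
    · exact ⟨trivial, trivial⟩
    · exact h.elim
    · exact h.elim
    · exact LV.types.tyPrec_self h
  tyPrec_trans {k l m} h h' := by
    cases k <;> cases l <;> cases m <;> first | exact h.elim | exact h'.elim | skip
    · trivial
    · exact LV.types.tyPrec_trans h h'

theorem IsLevel.lawful {i : ℕ} {V : Univ.{v}} (hV : IsLevel i V) : V.Lawful := by
  induction hV with
  | zero H => exact Ground.lawful_zero.univ H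
  | succ _ H ih => exact ih.succ.univ H

end Grip

theorem mainTheorem3 (i : ℕ) (V : Grip.Univ.{v}) (hV : Grip.IsLevel i V) (A B : V.Ty)
    (hAB : V.tyPrec A B) :
    Grip.IsEPPair (V.prec A) (V.prec B) (V.cast A B) (V.cast B A) := by
  have L := hV.lawful.types
  obtain ⟨hA, hB⟩ := L.tyPrec_self hAB
  exact L.laws.isEPPair hA hB hAB
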